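/- There is an absolute constant $C>1$ such that the following holds for every prime $p$. Let $G=\mathrm{SL}_2(\mathbb{F}_p)$ and let $A\subseteq G$ be a symmetric generating set of $G$ (that is, $A=A^{-1}$ and $A$ generates $G$) with $N=|A|>C$ elements. Then the Cayley graph of $G$ with respect to $A$ is connected and has diameter at most $$C\left(\frac{\log |G|}{\log (N/C)}\right)^{d},\qquad d=\log_{3/2}8\approx 5.13 .$$ -/

import Mathlib

/-! Put `S = A ∪ {1}` and `q = |F|`, where `F` is the field. The heart is the growth estimate `|S ^
k| ^ 3 ≤ 2 ^ 17 * |S ^ (8k + 7)| ^ 2`, valid while `|S ^ (2k)| ≤ q ^ 2`: the exponent of the power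
grows about eightfold while the logarithm of the size gains a factor 3/2, whence the exponent
`log_{3/2} 8`.

The estimate takes place in a conjugacy class. Some non-central `h ∈ S ^ (2k + 2)` commutes with
boundedly many elements of `S ^ (2k)` (`exists_card_commute_le`), so conjugating `h` by `S ^ k`
gives a set `X` of comparable size, all of one trace `t`. The equation `x * y = w` with `tr y = t`
says that `x` lies on the plane section `detPolar x w = t` of the class, a quadric surface. If all
plane sections of `X` have at most `√|X|` points, then `|X * X|` is at least about `|X| ^ (3/2)`.
Otherwise let `Z` be a richer section. Fixing the product of a point of `Z` and a point of `X`
confines the first factor to a line, and a line meets the quadric at most twice unless it is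
isotropic; after moving `X` into general position by a word of length three, `Z` times a large part
of `X` has size about `|Z| |X|`. Isotropic lines are handled separately, by an injectivity argument
(`card_pow_three_le_of_trace_eq`).

Once `|S ^ (2k)| > q ^ 2`, some power not much longer has small doubling, and the same argument
there produces a set `E` with `|E|` well above `q ^ (5/2)`. Such an `E` contains many unipotent
elements and many upper triangular ones in its square; a sum-product argument yields all unipotents,
hence the whole group, in boundedly many steps (`pow_eq_univ_of_card`). -/

/-! ### The determinant as a quadratic form on 2 × 2 matrices. -/

section MatrixAlgebra

open Matrix

variable {F : Type*} [Field F]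

/-- The polarisation of the determinant on `2 × 2` matrices. -/
def detPolar (x y : Matrix (Fin 2) (Fin 2) F) : F :=
  x 0 0 * y 1 1 + x 1 1 * y 0 0 - x 0 1 * y 1 0 - x 1 0 * y 0 1

omit [Field F] in
lemma matrix_fin_two_ext {x y : Matrix (Fin 2) (Fin 2) F} (h00 : x 0 0 = y 0 0)
    (h01 : x 0 1 = y 0 1) (h10 : x 1 0 = y 1 0) (h11 : x 1 1 = y 1 1) : x = y := by
  ext i j
  fin_cases i <;> fin_cases j <;> assumption

lemma det_add_smul (z n : Matrix (Fin 2) (Fin 2) F) (s : F) :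
    (z + s • n).det = z.det + s * detPolar z n + s ^ 2 * n.det := by
  simp [det_fin_two, detPolar]
  ring

lemma detPolar_add_smul (z n w : Matrix (Fin 2) (Fin 2) F) (s : F) :
    detPolar (z + s • n) w = detPolar z w + s * detPolar n w := by
  simp [detPolar]
  ring

lemma detPolar_sub (z n w : Matrix (Fin 2) (Fin 2) F) :
    detPolar (z - n) w = detPolar z w - detPolar n w := by
  simp [detPolar]
  ring

lemma det_sub_fin_two (x y : Matrix (Fin 2) (Fin 2) F) :
    (x - y).det = x.det - detPolar x y + y.det := by
  simp [det_fin_two, detPolar]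
  ring

/-- Three distinct collinear matrices of determinant one lie on an isotropic line. -/
lemma det_eq_zero_of_collinear {z n : Matrix (Fin 2) (Fin 2) F} {s : F} (hz : z.det = 1)
    (h1 : (z + n).det = 1) (hs : (z + s • n).det = 1) (hs0 : s ≠ 0) (hs1 : s ≠ 1) :
    n.det = 0 := by
  have h1' := det_add_smul z n 1
  rw [one_smul, h1, hz] at h1'
  rw [det_add_smul, hz] at hs
  have h : s * (s - 1) * n.det = 0 := by linear_combination hs + s * h1'
  simpa [hs0, sub_ne_zero.2 hs1] using h

/-- Modulo scalars a matrix is the triple (difference of diagonal entries, two off-diagonal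
entries); the hypotheses say that the triples of `v` and `w` are proportional, and `hv` that the
first is nonzero. -/
lemma mem_span_one_of_minors {v w : Matrix (Fin 2) (Fin 2) F} (hv : ∀ c : F, v ≠ c • 1)
    (h1 : (v 0 0 - v 1 1) * w 0 1 = (w 0 0 - w 1 1) * v 0 1)
    (h2 : (v 0 0 - v 1 1) * w 1 0 = (w 0 0 - w 1 1) * v 1 0)
    (h3 : v 0 1 * w 1 0 = w 0 1 * v 1 0) : ∃ a b : F, w = a • 1 + b • v := by
  by_cases h01 : v 0 1 = 0
  · by_cases h10 : v 1 0 = 0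
    · have hd : v 0 0 - v 1 1 ≠ 0 := by
        intro hd
        refine hv (v 0 0) (matrix_fin_two_ext ?_ ?_ ?_ ?_) <;> simp [h01, h10]
        exact (sub_eq_zero.1 hd).symm
      simp only [h01, h10, mul_zero, mul_eq_zero, hd, false_or] at h1 h2
      refine ⟨w 0 0 - (w 0 0 - w 1 1) / (v 0 0 - v 1 1) * v 0 0,
        (w 0 0 - w 1 1) / (v 0 0 - v 1 1), matrix_fin_two_ext ?_ ?_ ?_ ?_⟩ <;>
        simp [h01, h10, h1, h2]
      field_simp
      ring
    · refine ⟨w 0 0 - w 1 0 / v 1 0 * v 0 0, w 1 0 / v 1 0, matrix_fin_two_ext ?_ ?_ ?_ ?_⟩ <;>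
        simp
      · field_simp
        linear_combination -h3
      · field_simp
      · field_simp
        linear_combination h2
  · refine ⟨w 0 0 - w 0 1 / v 0 1 * v 0 0, w 0 1 / v 0 1, matrix_fin_two_ext ?_ ?_ ?_ ?_⟩ <;>
      simp
    · field_simp
    · field_simp
      linear_combination h3
    · field_simp
      linear_combination h1

lemma mem_span_one_of_commute {v w : Matrix (Fin 2) (Fin 2) F} (hv : ∀ c : F, v ≠ c • 1)
    (h : w * v = v * w) : ∃ a b : F, w = a • 1 + b • v := by
  have e := fun i j => congrFun (congrFun h i) j
  simp only [mul_apply, Fin.sum_univ_two] at e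
  apply mem_span_one_of_minors hv
  · linear_combination -e 0 1
  · linear_combination e 1 0
  · linear_combination -e 0 0

/-- Both `(a, b, c)` and `(a', b', c')` are orthogonal to two independent vectors, hence multiples
of their cross product `(X, Y, Z)`. -/
lemma minors_eq_of_orthogonal {a b c a' b' c' P Q R P' Q' R' : F}
    (h : a * P + b * Q + c * R = 0) (h' : a' * P + b' * Q + c' * R = 0)
    (k : a * P' + b * Q' + c * R' = 0) (k' : a' * P' + b' * Q' + c' * R' = 0)
    (hne : Q * R' - R * Q' ≠ 0 ∨ R * P' - P * R' ≠ 0 ∨ P * Q' - Q * P' ≠ 0) :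
    a * b' = a' * b ∧ a * c' = a' * c ∧ b * c' = b' * c := by
  generalize hX : Q * R' - R * Q' = X at hne
  generalize hY : R * P' - P * R' = Y at hne
  generalize hZ : P * Q' - Q * P' = Z at hne
  have e1 : a * Y = b * X := by subst hX hY; linear_combination k * R - h * R'
  have e2 : a * Z = c * X := by subst hX hZ; linear_combination -k * Q + h * Q'
  have e3 : b * Z = c * Y := by subst hY hZ; linear_combination k * P - h * P'
  have f1 : a' * Y = b' * X := by subst hX hY; linear_combination k' * R - h' * R'
  have f2 : a' * Z = c' * X := by subst hX hZ; linear_combination -k' * Q + h' * Q'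
  have f3 : b' * Z = c' * Y := by subst hY hZ; linear_combination k' * P - h' * P'
  clear h h' k k' hX hY hZ
  rcases hne with h | h | h
  · refine ⟨?_, ?_, ?_⟩ <;> refine mul_right_cancel₀ h ?_
    · linear_combination a' * e1 - a * f1
    · linear_combination a' * e2 - a * f2
    · linear_combination a' * e3 + c * f1 - b * f2
  · refine ⟨?_, ?_, ?_⟩ <;> refine mul_right_cancel₀ h ?_
    · linear_combination b' * e1 - b * f1
    · linear_combination c' * e1 + a' * e3 - b * f2
    · linear_combination b' * e3 - b * f3
  · refine ⟨?_, ?_, ?_⟩ <;> refine mul_right_cancel₀ h ?_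
    · linear_combination b' * e2 - c * f1 - a' * e3
    · linear_combination c' * e2 - c * f2
    · linear_combination c' * e3 - c * f3

lemma eq_smul_of_minors {n m : Matrix (Fin 2) (Fin 2) F} (hn : n ≠ 0) (hnt : n.trace = 0)
    (hmt : m.trace = 0) (h1 : n 0 0 * m 0 1 = m 0 0 * n 0 1) (h2 : n 0 0 * m 1 0 = m 0 0 * n 1 0)
    (h3 : n 0 1 * m 1 0 = m 0 1 * n 1 0) : ∃ s : F, m = s • n := by
  rw [trace_fin_two] at hnt hmt
  have hn1 : n 1 1 = - n 0 0 := by linear_combination hnt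
  have hm1 : m 1 1 = - m 0 0 := by linear_combination hmt
  by_cases h00 : n 0 0 = 0
  · by_cases h01 : n 0 1 = 0
    · by_cases h10 : n 1 0 = 0
      · exact absurd (matrix_fin_two_ext (by simp [h00]) (by simp [h01]) (by simp [h10])
          (by simp [hn1, h00])) hn
      · refine ⟨m 1 0 / n 1 0, matrix_fin_two_ext ?_ ?_ ?_ ?_⟩ <;>
          simp [hn1, hm1] <;> field_simp <;> grind
    · refine ⟨m 0 1 / n 0 1, matrix_fin_two_ext ?_ ?_ ?_ ?_⟩ <;>
        simp [hn1, hm1] <;> field_simp <;> grind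
  · refine ⟨m 0 0 / n 0 0, matrix_fin_two_ext ?_ ?_ ?_ ?_⟩ <;>
      simp [hn1, hm1] <;> field_simp <;> grind

/-- The traceless matrices orthogonal to a matrix `v` and to some `w` outside the span of `1` and
`v` are proportional. -/
lemma eq_smul_of_orthogonal {v w n m : Matrix (Fin 2) (Fin 2) F} (hv : ∀ c : F, v ≠ c • 1)
    (hw : ¬ ∃ a b : F, w = a • 1 + b • v) (hn : n ≠ 0) (hnt : n.trace = 0) (hmt : m.trace = 0)
    (hnv : detPolar n v = 0) (hmv : detPolar m v = 0) (hnw : detPolar n w = 0)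
    (hmw : detPolar m w = 0) : ∃ s : F, m = s • n := by
  have hn' := hnt
  have hm' := hmt
  rw [trace_fin_two] at hn' hm'
  simp only [detPolar] at hnv hmv hnw hmw
  obtain ⟨h1, h2, h3⟩ := minors_eq_of_orthogonal (a := n 0 0) (b := n 0 1) (c := n 1 0)
    (a' := m 0 0) (b' := m 0 1) (c' := m 1 0) (P := v 0 0 - v 1 1) (Q := v 1 0) (R := v 0 1)
    (P' := w 0 0 - w 1 1) (Q' := w 1 0) (R' := w 0 1)
    (by linear_combination v 0 0 * hn' - hnv) (by linear_combination v 0 0 * hm' - hmv)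
    (by linear_combination w 0 0 * hn' - hnw) (by linear_combination w 0 0 * hm' - hmw) (by
      by_contra! hcon
      refine hw (mem_span_one_of_minors hv ?_ ?_ ?_)
      · linear_combination -hcon.2.1
      · linear_combination hcon.2.2
      · linear_combination -hcon.1)
  exact eq_smul_of_minors hn hnt hmt h1 h2 h3

/-- Orthogonal nilpotent matrices are proportional. -/
lemma eq_smul_of_isotropic {n m : Matrix (Fin 2) (Fin 2) F} (hn : n ≠ 0) (hnt : n.trace = 0)
    (hmt : m.trace = 0) (hnd : n.det = 0) (hmd : m.det = 0) (h : detPolar n m = 0) :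
    ∃ s : F, m = s • n := by
  have hn' := hnt
  have hm' := hmt
  rw [trace_fin_two] at hn' hm'
  rw [det_fin_two] at hnd hmd
  rw [detPolar] at h
  have hn1 : n 1 1 = - n 0 0 := by linear_combination hn'
  have hm1 : m 1 1 = - m 0 0 := by linear_combination hm'
  rw [hn1] at hnd h
  rw [hm1] at hmd h
  refine eq_smul_of_minors hn hnt hmt ?_ ?_ ?_
  · rw [← sub_eq_zero, ← sq_eq_zero_iff]
    linear_combination -(m 0 1) ^ 2 * hnd - (n 0 1) ^ 2 * hmd + n 0 1 * m 0 1 * h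
  · rw [← sub_eq_zero, ← sq_eq_zero_iff]
    linear_combination -(m 1 0) ^ 2 * hnd - (n 1 0) ^ 2 * hmd + n 1 0 * m 1 0 * h
  · rw [← sub_eq_zero, ← sq_eq_zero_iff]
    linear_combination (2 * m 0 0 * n 0 0 - n 0 1 * m 1 0 - n 1 0 * m 0 1) * h
      - 4 * m 0 0 ^ 2 * hnd + 4 * n 0 1 * n 1 0 * hmd

/-- If `m₃` and `m₄` are vectors from a point `z` of a plane section of the quadric to points
off an isotropic line of that section through `z`, then `m₄ - m₃` is isotropic. -/
lemma det_sub_eq_zero_of_plane {z n m k : Matrix (Fin 2) (Fin 2) F} {s r : F} (hz : z.det = 1)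
    (hn : n.det = 0) (hzn : (z + n).det = 1) (hzm : (z + m).det = 1) (hzk : (z + k).det = 1)
    (hk : k = s • n + r • m) (hr : r ≠ 0) : (k - m).det = 0 := by
  subst hk
  simp only [det_fin_two, Matrix.add_apply, Matrix.sub_apply, Matrix.smul_apply, smul_eq_mul] at *
  -- On the plane through `z`, `det (z + s • n + r • m) - 1` equals `r` times this linear factor;
  -- the factor `r = 0` is the first isotropic line. Moreover `det (k - m)` is `r - 1` times the
  -- factor.
  have key : ((r - 1) * (m 0 0 * m 1 1 - m 0 1 * m 1 0) +
      s * (n 0 0 * m 1 1 + n 1 1 * m 0 0 - n 0 1 * m 1 0 - n 1 0 * m 0 1)) = 0 := by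
    refine (mul_eq_zero.1 ?_).resolve_left hr
    linear_combination hzk - hz - s * (hzn - hz - hn) - s ^ 2 * hn - r * (hzm - hz)
  linear_combination (r - 1) * key + s ^ 2 * hn

/-- The matrix `n` has rank one with equal range and kernel. Orthogonality to `z` means `tr (z * n)
= 0`, so `z` preserves that line, and `μ` is its eigenvalue there. -/
lemma mul_eq_smul_of_nilpotent {z n : Matrix (Fin 2) (Fin 2) F} (hn : n ≠ 0)
    (hnt : n.trace = 0) (hnd : n.det = 0) (hz : z.det = 1) (h : detPolar z n = 0) :
    ∃ μ : F, μ ≠ 0 ∧ z * n = μ • n := by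
  have key : ∃ μ : F, z * n = μ • n := by
    have hn' := hnt
    rw [trace_fin_two] at hn'
    rw [det_fin_two] at hnd
    rw [detPolar] at h
    have hn1 : n 1 1 = - n 0 0 := by linear_combination hn'
    rw [hn1] at hnd h
    by_cases h01 : n 0 1 = 0
    · have h00 : n 0 0 = 0 := by simpa [h01] using hnd
      have h10 : n 1 0 ≠ 0 := fun h10 => hn (matrix_fin_two_ext (by simp [h00]) (by simp [h01])
        (by simp [h10]) (by simp [hn1, h00]))
      have hz01 : z 0 1 = 0 := by simpa [h01, h00, h10] using h
      refine ⟨z 1 1, matrix_fin_two_ext ?_ ?_ ?_ ?_⟩ <;>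
        simp [mul_apply, Fin.sum_univ_two, h01, h00, hz01, hn1]
    · obtain ⟨c, hc⟩ : ∃ c, n 0 0 = c * n 0 1 := ⟨n 0 0 / n 0 1, by field_simp⟩
      have h10 : n 1 0 = -c ^ 2 * n 0 1 := by
        refine mul_right_cancel₀ h01 ?_
        rw [hc] at hnd
        linear_combination -hnd
      rw [h10, hc] at h
      refine ⟨z 0 0 - z 0 1 * c, matrix_fin_two_ext ?_ ?_ ?_ ?_⟩ <;>
        simp only [mul_apply, Fin.sum_univ_two, hn1, Matrix.smul_apply, smul_eq_mul, hc, h10]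
      · ring
      · ring
      · linear_combination -c * h
      · linear_combination -h
  obtain ⟨μ, hμ⟩ := key
  refine ⟨μ, ?_, hμ⟩
  rintro rfl
  rw [zero_smul] at hμ
  apply hn
  have := congrArg (fun y => z.adjugate * y) hμ
  simpa [← mul_assoc, adjugate_mul, hz] using this

lemma detPolar_mul_adjugate (x y : Matrix (Fin 2) (Fin 2) F) :
    detPolar x y = (x * y.adjugate).trace := by
  simp [detPolar, trace_fin_two, adjugate_fin_two, mul_apply, Fin.sum_univ_two]
  ring

end MatrixAlgebra

/-! ### Products of a plane section with a subset of a conjugacy class. -/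

section CurveSurface

open Matrix Finset
open scoped Pointwise

variable {F : Type*} [Field F]

lemma det_sub_eq_zero_of_smul {z₁ z₂ z₃ : Matrix (Fin 2) (Fin 2) F} {s : F} (h1 : z₁.det = 1)
    (h2 : z₂.det = 1) (h3 : z₃.det = 1) (h13 : z₁ ≠ z₃) (h23 : z₂ ≠ z₃)
    (h : z₃ - z₁ = s • (z₂ - z₁)) : (z₂ - z₁).det = 0 := by
  refine det_eq_zero_of_collinear (z := z₁) (s := s) h1 (by simpa using h2)
    (by rw [← h]; simpa using h3) ?_ ?_
  · rintro rfl
    rw [zero_smul, sub_eq_zero] at h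
    exact h13 h.symm
  · rintro rfl
    rw [one_smul, sub_left_inj] at h
    exact h23 h.symm

lemma trace_mul_of_span {v y z : Matrix (Fin 2) (Fin 2) F} {a b : F} (hy : y.det = 1)
    (h : z * y = a • 1 + b • v) : z = (a • 1 + b • v) * y.adjugate := by
  rw [← h, mul_assoc, mul_adjugate, hy, one_smul, mul_one]

/-- This turns the equation `z * y = w`, with the trace of `y` prescribed, into a linear condition
on `z`. -/
lemma detPolar_eq_trace_inv_mul (z w : SpecialLinearGroup (Fin 2) F) :
    detPolar (z : Matrix (Fin 2) (Fin 2) F) (w : Matrix (Fin 2) (Fin 2) F) =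
      ((z⁻¹ * w : SpecialLinearGroup (Fin 2) F) : Matrix (Fin 2) (Fin 2) F).trace := by
  rw [Matrix.SpecialLinearGroup.coe_mul, Matrix.SpecialLinearGroup.coe_inv]
  simp only [detPolar, trace_fin_two, adjugate_fin_two, mul_apply, Fin.sum_univ_two, of_apply,
    cons_val', cons_val_zero, cons_val_one, cons_val_fin_one]
  ring

variable [DecidableEq F]

/-- Such `z` equal `(a • 1 + b • v) * y⁻¹`, and `tr z = t` is a linear equation in `(a, b)`,
non-trivial by `hy`. Hence they lie on a line, and three of them would make that line isotropic,
against `hZ`. -/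
lemma card_filter_span_le_two {t : F} {v : Matrix (Fin 2) (Fin 2) F}
    {Z : Finset (SpecialLinearGroup (Fin 2) F)}
    (hZt : ∀ z ∈ Z, (z : Matrix (Fin 2) (Fin 2) F).trace = t)
    (hZ : ∀ z ∈ Z, ∀ z' ∈ Z, z ≠ z' →
      ((z : Matrix (Fin 2) (Fin 2) F) - (z' : Matrix (Fin 2) (Fin 2) F)).det ≠ 0)
    {y : SpecialLinearGroup (Fin 2) F}
    (hy : 2 * (v * (y : Matrix (Fin 2) (Fin 2) F)).trace ≠
      v.trace * (y : Matrix (Fin 2) (Fin 2) F).trace)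
    {B : Finset (SpecialLinearGroup (Fin 2) F)} (hBZ : B ⊆ Z)
    (hB : ∀ z ∈ B, ∃ a b : F,
      (z : Matrix (Fin 2) (Fin 2) F) * (y : Matrix (Fin 2) (Fin 2) F) = a • 1 + b • v) :
    B.card ≤ 2 := by
  by_contra! hcard
  obtain ⟨z₁, h1, z₂, h2, z₃, h3, h12, h13, h23⟩ := two_lt_card.1 hcard
  obtain ⟨a₁, b₁, e1⟩ := hB z₁ h1
  obtain ⟨a₂, b₂, e2⟩ := hB z₂ h2
  obtain ⟨a₃, b₃, e3⟩ := hB z₃ h3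
  replace e1 := trace_mul_of_span y.det_coe e1
  replace e2 := trace_mul_of_span y.det_coe e2
  replace e3 := trace_mul_of_span y.det_coe e3
  have ht : ∀ a b : F, ((a • 1 + b • v) * (y : Matrix (Fin 2) (Fin 2) F).adjugate).trace =
      a * (y : Matrix (Fin 2) (Fin 2) F).adjugate.trace +
        b * (v * (y : Matrix (Fin 2) (Fin 2) F).adjugate).trace := by
    intro a b
    rw [add_mul, trace_add, smul_mul_assoc, smul_mul_assoc, trace_smul, trace_smul, one_mul]
    rfl
  have t1 := hZt z₁ (hBZ h1)
  have t2 := hZt z₂ (hBZ h2)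
  have t3 := hZt z₃ (hBZ h3)
  rw [e1, ht] at t1
  rw [e2, ht] at t2
  rw [e3, ht] at t3
  have hαβ : (y : Matrix (Fin 2) (Fin 2) F).adjugate.trace ≠ 0 ∨
      (v * (y : Matrix (Fin 2) (Fin 2) F).adjugate).trace ≠ 0 := by
    by_contra! hcon
    apply hy
    obtain ⟨c1, c2⟩ := hcon
    simp only [trace_fin_two, adjugate_fin_two, mul_apply, Fin.sum_univ_two, of_apply,
      cons_val', cons_val_zero, cons_val_one, cons_val_fin_one] at c1 c2 ⊢
    linear_combination (v 0 0 + v 1 1) * c1 - 2 * c2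
  generalize (y : Matrix (Fin 2) (Fin 2) F).adjugate.trace = α at *
  generalize (v * (y : Matrix (Fin 2) (Fin 2) F).adjugate).trace = β at *
  have hne : (a₂ - a₁, b₂ - b₁) ≠ (0, 0) := by
    intro h
    rw [Prod.mk.injEq, sub_eq_zero, sub_eq_zero] at h
    apply h12
    ext1
    rw [e1, e2, h.1, h.2]
  have hs : ∃ s : F, a₃ - a₁ = s * (a₂ - a₁) ∧ b₃ - b₁ = s * (b₂ - b₁) := by
    rcases hαβ with h | h
    · have hb : b₂ - b₁ ≠ 0 := by
        intro hb
        apply hne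
        have : α * (a₂ - a₁) = 0 := by linear_combination t2 - t1 - β * hb
        rw [hb, (mul_eq_zero.1 this).resolve_left h]
      refine ⟨(b₃ - b₁) / (b₂ - b₁), ?_, by field_simp⟩
      refine mul_left_cancel₀ h ?_
      rw [div_mul_eq_mul_div, mul_div_assoc', eq_div_iff hb]
      linear_combination (b₂ - b₁) * (t3 - t1) - (b₃ - b₁) * (t2 - t1)
    · have ha : a₂ - a₁ ≠ 0 := by
        intro ha
        apply hne
        have : β * (b₂ - b₁) = 0 := by linear_combination t2 - t1 - α * ha
        rw [ha, (mul_eq_zero.1 this).resolve_left h]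
      refine ⟨(a₃ - a₁) / (a₂ - a₁), by field_simp, ?_⟩
      refine mul_left_cancel₀ h ?_
      rw [div_mul_eq_mul_div, mul_div_assoc', eq_div_iff ha]
      linear_combination (a₂ - a₁) * (t3 - t1) - (a₃ - a₁) * (t2 - t1)
  obtain ⟨s, hs1, hs2⟩ := hs
  refine hZ z₂ (hBZ h2) z₁ (hBZ h1) h12.symm (det_sub_eq_zero_of_smul (s := s) z₁.det_coe
    z₂.det_coe z₃.det_coe (fun h => h13 (Subtype.ext h)) (fun h => h23 (Subtype.ext h)) ?_)
  rw [e1, e2, e3, ← sub_mul, ← sub_mul, ← smul_mul_assoc]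
  congr 1
  rw [add_sub_add_comm, add_sub_add_comm, ← sub_smul, ← sub_smul, ← sub_smul, ← sub_smul,
    smul_add, smul_smul, smul_smul, hs1, hs2]

/-- The product of an anisotropic plane section of a conjugacy class and another subset of the
class is as large as it can be. -/
lemma card_mul_card_le_of_anisotropic {t t' : F} {v : Matrix (Fin 2) (Fin 2) F}
    (hv : ∀ c : F, v ≠ c • 1) {Z Y : Finset (SpecialLinearGroup (Fin 2) F)}
    (hZt : ∀ z ∈ Z, (z : Matrix (Fin 2) (Fin 2) F).trace = t)
    (hZv : ∀ z ∈ Z, detPolar (z : Matrix (Fin 2) (Fin 2) F) v = t')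
    (hZ : ∀ z ∈ Z, ∀ z' ∈ Z, z ≠ z' →
      ((z : Matrix (Fin 2) (Fin 2) F) - (z' : Matrix (Fin 2) (Fin 2) F)).det ≠ 0)
    (hYt : ∀ y ∈ Y, (y : Matrix (Fin 2) (Fin 2) F).trace = t)
    (hY : ∀ y ∈ Y, 2 * (v * (y : Matrix (Fin 2) (Fin 2) F)).trace ≠
      v.trace * (y : Matrix (Fin 2) (Fin 2) F).trace) :
    Z.card * Y.card ≤ 2 * (Z * Y).card + 2 * Y.card := by
  classical
  let bad : SpecialLinearGroup (Fin 2) F × SpecialLinearGroup (Fin 2) F → Prop := fun q =>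
    ∃ a b : F, (q.1 : Matrix (Fin 2) (Fin 2) F) * (q.2 : Matrix (Fin 2) (Fin 2) F) =
      a • 1 + b • v
  rw [← card_product, ← card_filter_add_card_filter_not bad, add_comm]
  refine add_le_add ?_ ?_
  · refine card_le_mul_card_image_of_maps_to (f := fun q => q.1 * q.2) (t := Z * Y) ?_ 2 ?_
    · intro q hq
      rw [mem_filter, mem_product] at hq
      exact mul_mem_mul hq.1.1 hq.1.2
    -- For a product `w` outside the span of `1` and `v`, the first factor has prescribed `detPolar`
    -- with the independent matrices `1`, `v` and `w`. This confines it to a line, which is not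
    -- isotropic and so carries at most two points.
    · intro w _
      by_contra! hcard
      obtain ⟨⟨z₁, y₁⟩, h1, ⟨z₂, y₂⟩, h2, ⟨z₃, y₃⟩, h3, h12, h13, h23⟩ := two_lt_card.1 hcard
      simp only [mem_filter, mem_product] at h1 h2 h3
      obtain ⟨⟨⟨hz1, hy1⟩, hb⟩, hw1⟩ := h1
      obtain ⟨⟨⟨hz2, hy2⟩, -⟩, hw2⟩ := h2
      obtain ⟨⟨⟨hz3, hy3⟩, -⟩, hw3⟩ := h3
      have n12 : z₁ ≠ z₂ := fun h => h12 (by subst h; rw [← hw2, mul_right_inj] at hw1; rw [hw1])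
      have n13 : z₁ ≠ z₃ := fun h => h13 (by subst h; rw [← hw3, mul_right_inj] at hw1; rw [hw1])
      have n23 : z₂ ≠ z₃ := fun h => h23 (by subst h; rw [← hw3, mul_right_inj] at hw2; rw [hw2])
      have hp : ∀ z ∈ Z, ∀ y ∈ Y, z * y = w →
          detPolar (z : Matrix (Fin 2) (Fin 2) F) (w : Matrix (Fin 2) (Fin 2) F) = t := by
        rintro z - y hy rfl
        rw [detPolar_eq_trace_inv_mul, inv_mul_cancel_left, hYt y hy]
      have hbw : ¬ ∃ a b : F, (w : Matrix (Fin 2) (Fin 2) F) = a • 1 + b • v := by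
        rw [← hw1]
        simpa [bad] using hb
      obtain ⟨s, hs⟩ := eq_smul_of_orthogonal (v := v) (w := (w : Matrix (Fin 2) (Fin 2) F))
        (n := (z₂ : Matrix (Fin 2) (Fin 2) F) - (z₁ : Matrix (Fin 2) (Fin 2) F))
        (m := (z₃ : Matrix (Fin 2) (Fin 2) F) - (z₁ : Matrix (Fin 2) (Fin 2) F)) hv hbw
        (fun h => n12 (Subtype.ext (sub_eq_zero.1 h).symm))
        (by rw [trace_sub, hZt _ hz1, hZt _ hz2, sub_self])
        (by rw [trace_sub, hZt _ hz1, hZt _ hz3, sub_self])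
        (by rw [detPolar_sub, hZv _ hz1, hZv _ hz2, sub_self])
        (by rw [detPolar_sub, hZv _ hz1, hZv _ hz3, sub_self])
        (by rw [detPolar_sub, hp _ hz1 _ hy1 hw1, hp _ hz2 _ hy2 hw2, sub_self])
        (by rw [detPolar_sub, hp _ hz1 _ hy1 hw1, hp _ hz3 _ hy3 hw3, sub_self])
      exact hZ z₂ hz2 z₁ hz1 n12.symm (det_sub_eq_zero_of_smul z₁.det_coe z₂.det_coe z₃.det_coe
        (fun h => n13 (Subtype.ext h)) (fun h => n23 (Subtype.ext h)) hs)
  · refine card_le_mul_card_image_of_maps_to (f := Prod.snd) (t := Y) ?_ 2 ?_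
    · intro q hq
      rw [mem_filter, mem_product] at hq
      exact hq.1.2
    · intro y hy
      let B := ({q ∈ {q ∈ Z ×ˢ Y | bad q} | q.2 = y}).image Prod.fst
      have hinj : B.card = ({q ∈ {q ∈ Z ×ˢ Y | bad q} | q.2 = y}).card := by
        refine card_image_of_injOn ?_
        intro q hq q' hq' h
        simp only [coe_filter, mem_filter, Set.mem_ofPred_eq] at hq hq'
        exact Prod.ext h (hq.2.trans hq'.2.symm)
      rw [← hinj]
      refine card_filter_span_le_two hZt hZ (hY y hy) (B := B) ?_ ?_
      · intro z hz
        simp only [B, mem_image, mem_filter, mem_product] at hz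
        obtain ⟨q, hq, rfl⟩ := hz
        exact hq.1.1.1
      · intro z hz
        simp only [B, mem_image, mem_filter, mem_product] at hz
        obtain ⟨q, hq, rfl⟩ := hz
        obtain ⟨⟨_, hb⟩, rfl⟩ := hq
        exact hb

/-- The product of a subset of an isotropic line of a conjugacy class and another subset of the
class is as large as it can be. -/
lemma card_mul_card_eq_of_isotropic {t : F} {z₀ n : Matrix (Fin 2) (Fin 2) F}
    (hn : n ≠ 0) (hnt : n.trace = 0) (hnd : n.det = 0) (hz₀ : detPolar z₀ n = 0)
    {Z Y : Finset (SpecialLinearGroup (Fin 2) F)}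
    (hZ : ∀ z ∈ Z, ∃ s : F, (z : Matrix (Fin 2) (Fin 2) F) = z₀ + s • n)
    (hYt : ∀ y ∈ Y, (y : Matrix (Fin 2) (Fin 2) F).trace = t)
    (hY : ∀ y ∈ Y, (n * (y : Matrix (Fin 2) (Fin 2) F)).trace ≠ 0) :
    (Z * Y).card = Z.card * Y.card := by
  refine card_mul_iff.2 ?_
  rintro ⟨z, y⟩ ⟨hz, hy⟩ ⟨z', y'⟩ ⟨hz', hy'⟩ h
  simp only [mem_coe] at hz hy hz' hy' h
  have hzz : z = z' := by
    have hp : detPolar (z : Matrix (Fin 2) (Fin 2) F)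
        ((z * y : SpecialLinearGroup (Fin 2) F) : Matrix (Fin 2) (Fin 2) F) = t := by
      rw [detPolar_eq_trace_inv_mul, inv_mul_cancel_left, hYt y hy]
    have hp' : detPolar (z' : Matrix (Fin 2) (Fin 2) F)
        ((z * y : SpecialLinearGroup (Fin 2) F) : Matrix (Fin 2) (Fin 2) F) = t := by
      rw [h, detPolar_eq_trace_inv_mul, inv_mul_cancel_left, hYt y' hy']
    obtain ⟨s, hs⟩ := hZ z hz
    obtain ⟨s', hs'⟩ := hZ z' hz'
    rw [hs, detPolar_add_smul] at hp
    rw [hs', detPolar_add_smul] at hp'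
    -- On the line, `detPolar z w = t` is an affine equation in the parameter `s`. Its slope is `-μ
    -- * tr (n * y)`, with `μ` the eigenvalue of `z⁻¹` on the range of `n`; so `w` determines `z`.
    have hne : detPolar n
        ((z * y : SpecialLinearGroup (Fin 2) F) : Matrix (Fin 2) (Fin 2) F) ≠ 0 := by
      have hzi : detPolar (z : Matrix (Fin 2) (Fin 2) F).adjugate n = 0 := by
        have : detPolar (z : Matrix (Fin 2) (Fin 2) F) n = 0 := by
          rw [hs, detPolar_add_smul, hz₀]
          rw [det_fin_two] at hnd
          simp only [detPolar]
          linear_combination 2 * s * hnd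
        rw [trace_fin_two] at hnt
        simp only [detPolar, adjugate_fin_two, of_apply, cons_val', cons_val_zero, cons_val_one,
          cons_val_fin_one] at this ⊢
        linear_combination (z 0 0 + z 1 1) * hnt - this
      obtain ⟨μ, hμ, e⟩ := mul_eq_smul_of_nilpotent hn hnt hnd
        (by rw [det_adjugate, z.det_coe]; simp) hzi
      have : detPolar n ((z * y : SpecialLinearGroup (Fin 2) F) : Matrix (Fin 2) (Fin 2) F) =
          - (μ * (n * (y : Matrix (Fin 2) (Fin 2) F)).trace) := by
        rw [detPolar_mul_adjugate, Matrix.SpecialLinearGroup.coe_mul, adjugate_mul_distrib,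
          ← mul_assoc,
          trace_mul_comm, ← mul_assoc, e, smul_mul_assoc, trace_smul, smul_eq_mul]
        rw [trace_fin_two] at hnt
        simp only [trace_fin_two, adjugate_fin_two, mul_apply, Fin.sum_univ_two, of_apply,
          cons_val', cons_val_zero, cons_val_one, cons_val_fin_one]
        linear_combination μ * (y 0 0 + y 1 1) * hnt
      rw [this]
      exact neg_ne_zero.2 (mul_ne_zero hμ (hY y hy))
    have hss : s = s' := by
      refine mul_right_cancel₀ hne ?_
      linear_combination hp - hp'
    exact Subtype.ext (by rw [hs, hs', hss])
  subst hzz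
  rw [mul_right_inj] at h
  rw [h]

end CurveSurface

/-! ### Plane sections that contain an isotropic line. -/

section PlaneSections

open Matrix Finset

variable {F : Type*} [Field F]

/-- Three vectors in the plane orthogonal to `(P, Q, R)`: Cramer's rule in the last two coordinates,
the first being recovered from `P ≠ 0`. The other coordinates are reached by cyclic or transposed
relabelling. -/
lemma minors_eq_or_exists_combination_aux {a b c a' b' c' a'' b'' c'' P Q R : F}
    (h : a * P + b * Q + c * R = 0) (h' : a' * P + b' * Q + c' * R = 0)
    (h'' : a'' * P + b'' * Q + c'' * R = 0) (hP : P ≠ 0) :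
    (a * b' = a' * b ∧ a * c' = a' * c ∧ b * c' = b' * c) ∨
      ∃ s r, a'' = s * a + r * a' ∧ b'' = s * b + r * b' ∧ c'' = s * c + r * c' := by
  by_cases hD : b * c' - b' * c = 0
  · left
    refine ⟨?_, ?_, sub_eq_zero.1 hD⟩ <;> refine mul_right_cancel₀ hP ?_
    · linear_combination b' * h - b * h' + R * hD
    · linear_combination c' * h - c * h' - Q * hD
  · right
    refine ⟨(b'' * c' - c'' * b') / (b * c' - b' * c), (b * c'' - c * b'') / (b * c' - b' * c),
      ?_, ?_, ?_⟩
    · refine mul_right_cancel₀ hP ?_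
      rw [div_mul_eq_mul_div, div_mul_eq_mul_div, ← add_div, div_mul_eq_mul_div, eq_div_iff hD]
      linear_combination (b * c' - b' * c) * h'' - (b'' * c' - c'' * b') * h -
        (b * c'' - c * b'') * h'
    · rw [div_mul_eq_mul_div, div_mul_eq_mul_div, ← add_div, eq_div_iff hD]
      ring
    · rw [div_mul_eq_mul_div, div_mul_eq_mul_div, ← add_div, eq_div_iff hD]
      ring

/-- The traceless matrices orthogonal to a non-scalar matrix form a plane. -/
lemma exists_combination_of_orthogonal {v n m k : Matrix (Fin 2) (Fin 2) F}
    (hv : ∀ c : F, v ≠ c • 1) (hn : n ≠ 0) (hnt : n.trace = 0) (hmt : m.trace = 0)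
    (hkt : k.trace = 0) (hnv : detPolar n v = 0) (hmv : detPolar m v = 0)
    (hkv : detPolar k v = 0) (hm : ¬ ∃ s : F, m = s • n) :
    ∃ s r : F, k = s • n + r • m := by
  have hn' := hnt
  have hm' := hmt
  have hk' := hkt
  rw [trace_fin_two] at hn' hm' hk'
  simp only [detPolar] at hnv hmv hkv
  have en : n 0 0 * (v 0 0 - v 1 1) + n 0 1 * v 1 0 + n 1 0 * v 0 1 = 0 := by
    linear_combination v 0 0 * hn' - hnv
  have em : m 0 0 * (v 0 0 - v 1 1) + m 0 1 * v 1 0 + m 1 0 * v 0 1 = 0 := by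
    linear_combination v 0 0 * hm' - hmv
  have ek : k 0 0 * (v 0 0 - v 1 1) + k 0 1 * v 1 0 + k 1 0 * v 0 1 = 0 := by
    linear_combination v 0 0 * hk' - hkv
  have hm2 : ¬ (n 0 0 * m 0 1 = m 0 0 * n 0 1 ∧ n 0 0 * m 1 0 = m 0 0 * n 1 0 ∧
      n 0 1 * m 1 0 = m 0 1 * n 1 0) := fun h =>
    hm (eq_smul_of_minors hn hnt hmt h.1 h.2.1 h.2.2)
  have key : ∃ s r : F, k 0 0 = s * n 0 0 + r * m 0 0 ∧ k 0 1 = s * n 0 1 + r * m 0 1 ∧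
      k 1 0 = s * n 1 0 + r * m 1 0 := by
    by_cases hP : v 0 0 - v 1 1 = 0
    · by_cases hQ : v 1 0 = 0
      · have hR : v 0 1 ≠ 0 := by
          intro hR
          refine hv (v 0 0) (matrix_fin_two_ext ?_ ?_ ?_ ?_) <;> simp [hQ, hR]
          exact (sub_eq_zero.1 hP).symm
        rcases minors_eq_or_exists_combination_aux
          (show n 1 0 * v 0 1 + n 0 0 * (v 0 0 - v 1 1) + n 0 1 * v 1 0 = 0 by
            linear_combination en)
          (show m 1 0 * v 0 1 + m 0 0 * (v 0 0 - v 1 1) + m 0 1 * v 1 0 = 0 by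
            linear_combination em)
          (show k 1 0 * v 0 1 + k 0 0 * (v 0 0 - v 1 1) + k 0 1 * v 1 0 = 0 by
            linear_combination ek) hR with h | ⟨s, r, h1, h2, h3⟩
        · exact absurd ⟨h.2.2, by linear_combination -h.1, by linear_combination -h.2.1⟩ hm2
        · exact ⟨s, r, h2, h3, h1⟩
      · rcases minors_eq_or_exists_combination_aux
          (show n 0 1 * v 1 0 + n 0 0 * (v 0 0 - v 1 1) + n 1 0 * v 0 1 = 0 by
            linear_combination en)
          (show m 0 1 * v 1 0 + m 0 0 * (v 0 0 - v 1 1) + m 1 0 * v 0 1 = 0 by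
            linear_combination em)
          (show k 0 1 * v 1 0 + k 0 0 * (v 0 0 - v 1 1) + k 1 0 * v 0 1 = 0 by
            linear_combination ek) hQ with h | ⟨s, r, h1, h2, h3⟩
        · exact absurd ⟨by linear_combination -h.1, h.2.2, h.2.1⟩ hm2
        · exact ⟨s, r, h2, h1, h3⟩
    · exact (minors_eq_or_exists_combination_aux en em ek hP).resolve_left hm2
  obtain ⟨s, r, h1, h2, h3⟩ := key
  refine ⟨s, r, matrix_fin_two_ext (by simpa using h1) (by simpa using h2) (by simpa using h3) ?_⟩
  simp only [Matrix.add_apply, Matrix.smul_apply, smul_eq_mul]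
  linear_combination hk' - h1 - s * hn' - r * hm'

/-- A plane section of a conjugacy class containing two points on an isotropic line is the union
of two isotropic lines, so that half of it lies on such a line. -/
lemma exists_isotropic_half {t t' : F} {v : Matrix (Fin 2) (Fin 2) F}
    (hv : ∀ c : F, v ≠ c • 1) {Z : Finset (SpecialLinearGroup (Fin 2) F)}
    (hZt : ∀ z ∈ Z, (z : Matrix (Fin 2) (Fin 2) F).trace = t)
    (hZv : ∀ z ∈ Z, detPolar (z : Matrix (Fin 2) (Fin 2) F) v = t')
    {z₁ z₂ : SpecialLinearGroup (Fin 2) F} (h1 : z₁ ∈ Z) (h2 : z₂ ∈ Z) (h12 : z₁ ≠ z₂)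
    (hd : ((z₂ : Matrix (Fin 2) (Fin 2) F) - (z₁ : Matrix (Fin 2) (Fin 2) F)).det = 0) :
    ∃ Z' ⊆ Z, Z.card ≤ 2 * Z'.card ∧ ∃ z₀ n : Matrix (Fin 2) (Fin 2) F, n ≠ 0 ∧ n.trace = 0 ∧
      n.det = 0 ∧ detPolar z₀ n = 0 ∧
      ∀ z ∈ Z', ∃ s : F, (z : Matrix (Fin 2) (Fin 2) F) = z₀ + s • n := by
  classical
  have hpol : ∀ z w : SpecialLinearGroup (Fin 2) F,
      ((w : Matrix (Fin 2) (Fin 2) F) - (z : Matrix (Fin 2) (Fin 2) F)).det = 0 →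
      detPolar (z : Matrix (Fin 2) (Fin 2) F)
        ((w : Matrix (Fin 2) (Fin 2) F) - (z : Matrix (Fin 2) (Fin 2) F)) = 0 := by
    intro z w h
    have e := det_add_smul (z : Matrix (Fin 2) (Fin 2) F)
      ((w : Matrix (Fin 2) (Fin 2) F) - (z : Matrix (Fin 2) (Fin 2) F)) 1
    rw [one_smul, add_sub_cancel, w.det_coe, z.det_coe, h] at e
    linear_combination -e
  have hne : ∀ z w : SpecialLinearGroup (Fin 2) F, z ≠ w →
      (w : Matrix (Fin 2) (Fin 2) F) - (z : Matrix (Fin 2) (Fin 2) F) ≠ 0 :=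
    fun z w h h' => h (Subtype.ext (sub_eq_zero.1 h').symm)
  set n := (z₂ : Matrix (Fin 2) (Fin 2) F) - (z₁ : Matrix (Fin 2) (Fin 2) F) with hn
  let L : Finset (SpecialLinearGroup (Fin 2) F) :=
    {z ∈ Z | ∃ s : F, (z : Matrix (Fin 2) (Fin 2) F) = z₁ + s • n}
  let R : Finset (SpecialLinearGroup (Fin 2) F) :=
    {z ∈ Z | ¬ ∃ s : F, (z : Matrix (Fin 2) (Fin 2) F) = z₁ + s • n}
  have hLR : L.card + R.card = Z.card := by
    simp only [L, R]
    rw [card_filter_add_card_filter_not]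
  by_cases hcard : R.card ≤ L.card
  · refine ⟨L, filter_subset _ _, by omega, z₁, n, hne _ _ h12, ?_, hd, hpol _ _ hd, ?_⟩
    · rw [hn, trace_sub, hZt _ h1, hZt _ h2, sub_self]
    · intro z hz
      exact (mem_filter.1 hz).2
  · have hL : 2 ≤ L.card := by
      have : ({z₁, z₂} : Finset (SpecialLinearGroup (Fin 2) F)) ⊆ L := by
        intro z hz
        rw [mem_insert, mem_singleton] at hz
        rcases hz with rfl | rfl
        · exact mem_filter.2 ⟨h1, 0, by simp⟩
        · exact mem_filter.2 ⟨h2, 1, by simp [hn]⟩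
      exact (card_pair h12).symm.le.trans (card_le_card this)
    -- The points off the first isotropic line are joined pairwise by isotropic vectors, so they
    -- fill a second line; the larger of the two parts is at least half of `Z`.
    have hR : ∀ z ∈ R, ∀ w ∈ R,
        ((w : Matrix (Fin 2) (Fin 2) F) - (z : Matrix (Fin 2) (Fin 2) F)).det = 0 := by
      intro z hz w hw
      obtain ⟨hzZ, hzL⟩ := mem_filter.1 hz
      obtain ⟨hwZ, hwL⟩ := mem_filter.1 hw
      obtain ⟨s, r, e⟩ := exists_combination_of_orthogonal (n := n)
        (m := (z : Matrix (Fin 2) (Fin 2) F) - (z₁ : Matrix (Fin 2) (Fin 2) F))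
        (k := (w : Matrix (Fin 2) (Fin 2) F) - (z₁ : Matrix (Fin 2) (Fin 2) F)) hv (hne _ _ h12)
        (by rw [hn, trace_sub, hZt _ h1, hZt _ h2, sub_self])
        (by rw [trace_sub, hZt _ h1, hZt _ hzZ, sub_self])
        (by rw [trace_sub, hZt _ h1, hZt _ hwZ, sub_self])
        (by rw [hn, detPolar_sub, hZv _ h1, hZv _ h2, sub_self])
        (by rw [detPolar_sub, hZv _ h1, hZv _ hzZ, sub_self])
        (by rw [detPolar_sub, hZv _ h1, hZv _ hwZ, sub_self])
        (fun ⟨s, hs⟩ => hzL ⟨s, by rw [← hs, add_sub_cancel]⟩)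
      have hr : r ≠ 0 := by
        rintro rfl
        refine hwL ⟨s, ?_⟩
        rw [zero_smul, add_zero] at e
        rw [← e, add_sub_cancel]
      have := det_sub_eq_zero_of_plane z₁.det_coe hd (by rw [hn, add_sub_cancel, z₂.det_coe])
        (by rw [add_sub_cancel, z.det_coe]) (by rw [add_sub_cancel, w.det_coe]) e hr
      rwa [sub_sub_sub_cancel_right] at this
    obtain ⟨z₃, h3, z₄, h4, h34⟩ := one_lt_card.1 (show 1 < R.card by omega)
    refine ⟨R, filter_subset _ _, by omega, z₃,
      (z₄ : Matrix (Fin 2) (Fin 2) F) - (z₃ : Matrix (Fin 2) (Fin 2) F), hne _ _ h34, ?_,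
      hR _ h3 _ h4, hpol _ _ (hR _ h3 _ h4), ?_⟩
    · rw [trace_sub, hZt _ (mem_filter.1 h3).1, hZt _ (mem_filter.1 h4).1, sub_self]
    · intro z hz
      obtain ⟨s, hs⟩ := eq_smul_of_isotropic
        (n := (z₄ : Matrix (Fin 2) (Fin 2) F) - (z₃ : Matrix (Fin 2) (Fin 2) F))
        (m := (z : Matrix (Fin 2) (Fin 2) F) - (z₃ : Matrix (Fin 2) (Fin 2) F)) (hne _ _ h34)
        (by rw [trace_sub, hZt _ (mem_filter.1 h3).1, hZt _ (mem_filter.1 h4).1, sub_self])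
        (by rw [trace_sub, hZt _ (mem_filter.1 h3).1, hZt _ (mem_filter.1 hz).1, sub_self])
        (hR _ h3 _ h4) (hR _ h3 _ hz) (by
          have e := det_sub_fin_two
            ((z₄ : Matrix (Fin 2) (Fin 2) F) - (z₃ : Matrix (Fin 2) (Fin 2) F))
            ((z : Matrix (Fin 2) (Fin 2) F) - (z₃ : Matrix (Fin 2) (Fin 2) F))
          rw [sub_sub_sub_cancel_right, hR _ hz _ h4, hR _ h3 _ h4, hR _ h3 _ hz] at e
          linear_combination e)
      exact ⟨s, by rw [← hs, add_sub_cancel]⟩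

end PlaneSections

/-! ### Moving a set into general position by short conjugations. -/

section Spreading

open Matrix Finset
open scoped Pointwise

variable {F : Type*} [Field F]

/-- Over a field of characteristic not two, the traceless matrices are an irreducible
representation of `SL₂` under conjugation. -/
lemma mem_of_conj_invariant (h2 : (2 : F) ≠ 0) {W : Submodule F (Matrix (Fin 2) (Fin 2) F)}
    (hW : ∀ g : SpecialLinearGroup (Fin 2) F, ∀ m ∈ W,
      (g : Matrix (Fin 2) (Fin 2) F) * m * (g : Matrix (Fin 2) (Fin 2) F).adjugate ∈ W)
    {v : Matrix (Fin 2) (Fin 2) F} (hv : v ∈ W) (hv0 : v ≠ 0) (hvt : v.trace = 0) :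
    !![0, 1; 0, 0] ∈ W ∧ !![0, 0; 1, 0] ∈ W ∧ !![1, 0; 0, -1] ∈ W := by
  have hu : ∀ s : F, (!![1, s; 0, 1] : Matrix (Fin 2) (Fin 2) F).det = 1 := fun s => by
    simp [det_fin_two]
  have hU : ∀ s : F, ∀ m ∈ W, !![m 0 0 + s * m 1 0, m 0 1 + s * (m 1 1 - m 0 0) - s ^ 2 * m 1 0;
      m 1 0, m 1 1 - s * m 1 0] ∈ W := by
    intro s m hm
    convert hW ⟨_, hu s⟩ m hm using 1
    refine matrix_fin_two_ext ?_ ?_ ?_ ?_ <;>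
      simp only [adjugate_fin_two, Matrix.mul_apply, Fin.sum_univ_two, of_apply, cons_val',
        cons_val_zero, cons_val_one, cons_val_fin_one] <;> ring
  rw [trace_fin_two] at hvt
  have hv1 : v 1 1 = - v 0 0 := by linear_combination hvt
  -- Conjugation by unipotents is quadratic in the parameter: its second difference isolates `-2 * v
  -- 1 0` times the nilpotent matrix, and if `v 1 0 = 0` the first difference isolates `-2 * v 0 0`
  -- times it.
  have hE : !![0, 1; 0, 0] ∈ W := by
    by_cases hc : v 1 0 = 0
    · by_cases ha : v 0 0 = 0
      · have hb : v 0 1 ≠ 0 := fun hb => hv0 (matrix_fin_two_ext (by simp [ha]) (by simp [hb])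
          (by simp [hc]) (by simp [hv1, ha]))
        have := W.smul_mem (v 0 1)⁻¹ hv
        convert this using 1
        refine matrix_fin_two_ext ?_ ?_ ?_ ?_ <;> simp [ha, hc, hv1, hb]
      · have h2a : -(2 * v 0 0) ≠ 0 := neg_ne_zero.2 (mul_ne_zero h2 ha)
        have := W.smul_mem (-(2 * v 0 0))⁻¹ (W.sub_mem (hU 1 v hv) hv)
        convert this using 1
        rw [eq_inv_smul_iff₀ h2a]
        refine matrix_fin_two_ext ?_ ?_ ?_ ?_ <;> simp [hc, hv1]
        ring
    · have h2a : -(2 * v 1 0) ≠ 0 := neg_ne_zero.2 (mul_ne_zero h2 hc)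
      have := W.smul_mem (-(2 * v 1 0))⁻¹
        (W.sub_mem (W.add_mem (hU 1 v hv) (hU (-1) v hv)) (W.smul_mem 2 hv))
      convert this using 1
      rw [eq_inv_smul_iff₀ h2a]
      refine matrix_fin_two_ext ?_ ?_ ?_ ?_ <;> simp [hv1] <;> ring
  have hFm : !![0, 0; 1, 0] ∈ W := by
    have := W.neg_mem (hW ⟨!![0, 1; -1, 0], by simp [det_fin_two]⟩ _ hE)
    convert this using 1
    simp [adjugate_fin_two]
  refine ⟨hE, hFm, ?_⟩
  have := W.add_mem (W.sub_mem (hU 1 _ hFm) hFm) hE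
  convert this using 1
  simp

lemma exists_trace_mul_ne_zero (h2 : (2 : F) ≠ 0) {W : Submodule F (Matrix (Fin 2) (Fin 2) F)}
    (hW : ∀ g : SpecialLinearGroup (Fin 2) F, ∀ m ∈ W,
      (g : Matrix (Fin 2) (Fin 2) F) * m * (g : Matrix (Fin 2) (Fin 2) F).adjugate ∈ W)
    {v : Matrix (Fin 2) (Fin 2) F} (hv : v ∈ W) (hv0 : v ≠ 0) (hvt : v.trace = 0)
    {x : Matrix (Fin 2) (Fin 2) F} (hx : ∀ c : F, x ≠ c • 1) :
    ∃ m ∈ W, (m * x).trace ≠ 0 := by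
  by_contra! hcon
  obtain ⟨h1, h3, h4⟩ := mem_of_conj_invariant h2 hW hv hv0 hvt
  have e1 := hcon _ h1
  have e3 := hcon _ h3
  have e4 := hcon _ h4
  simp only [trace_fin_two, Matrix.mul_apply, Fin.sum_univ_two, of_apply, cons_val',
    cons_val_zero, cons_val_one, cons_val_fin_one] at e1 e3 e4
  refine hx (x 0 0) (matrix_fin_two_ext ?_ ?_ ?_ ?_) <;>
    simp only [Matrix.smul_apply, Matrix.one_apply, smul_eq_mul]
  · simp
  · simpa using e3
  · simpa using e1
  · simp only [if_true, mul_one]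
    linear_combination -e4

/-- The span of the conjugates of `v` by inverses of elements of `T`. -/
def conjSpan (v : Matrix (Fin 2) (Fin 2) F) (T : Finset (SpecialLinearGroup (Fin 2) F)) :
    Submodule F (Matrix (Fin 2) (Fin 2) F) :=
  Submodule.span F ((fun g : SpecialLinearGroup (Fin 2) F =>
    (g : Matrix (Fin 2) (Fin 2) F).adjugate * v * (g : Matrix (Fin 2) (Fin 2) F)) '' T)

lemma conjSpan_mono (v : Matrix (Fin 2) (Fin 2) F) {T T' : Finset (SpecialLinearGroup (Fin 2) F)}
    (h : T ⊆ T') : conjSpan v T ≤ conjSpan v T' :=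
  Submodule.span_mono (Set.image_mono (by exact_mod_cast h))

lemma conj_mem_conjSpan {v : Matrix (Fin 2) (Fin 2) F}
    {T T' : Finset (SpecialLinearGroup (Fin 2) F)} {a : SpecialLinearGroup (Fin 2) F}
    (h : ∀ g ∈ T, g * a ∈ T') {m : Matrix (Fin 2) (Fin 2) F} (hm : m ∈ conjSpan v T) :
    (a : Matrix (Fin 2) (Fin 2) F).adjugate * m * (a : Matrix (Fin 2) (Fin 2) F) ∈
      conjSpan v T' := by
  induction hm using Submodule.span_induction with
  | mem x hx =>
    obtain ⟨g, hg, rfl⟩ := hx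
    refine Submodule.subset_span ⟨g * a, by exact_mod_cast h g (by exact_mod_cast hg), ?_⟩
    simp only [Matrix.SpecialLinearGroup.coe_mul, adjugate_mul_distrib, mul_assoc]
  | zero => simp
  | add x y _ _ hx hy => rw [mul_add, add_mul]; exact Submodule.add_mem _ hx hy
  | smul c x _ hx =>
    rw [mul_smul_comm, smul_mul_assoc]
    exact Submodule.smul_mem _ _ hx

/-- The spans increase with `i`; starting in dimension at least one, they cannot increase strictly
four times inside a space of dimension four. -/
lemma exists_conjSpan_eq [DecidableEq F] [Fintype F] {v : Matrix (Fin 2) (Fin 2) F} (hv : v ≠ 0)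
    {S : Finset (SpecialLinearGroup (Fin 2) F)} (h1 : 1 ∈ S) :
    ∃ i ≤ 3, conjSpan v (S ^ i) = conjSpan v (S ^ (i + 1)) := by
  by_contra! hcon
  have hlt : ∀ i ≤ 3, conjSpan v (S ^ i) < conjSpan v (S ^ (i + 1)) := fun i hi =>
    lt_of_le_of_ne (conjSpan_mono v (pow_subset_pow_right h1 (Nat.le_succ i))) (hcon i hi)
  have h0 : 1 ≤ Module.finrank F (conjSpan v (S ^ 0)) := by
    rw [Nat.one_le_iff_ne_zero, ne_eq, Submodule.finrank_eq_zero]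
    intro h
    refine hv ((Submodule.mem_bot F).1 (h ▸ Submodule.subset_span ⟨1, by simp, by simp⟩))
  have a0 := Submodule.finrank_lt_finrank_of_lt (hlt 0 (by norm_num))
  have a1 := Submodule.finrank_lt_finrank_of_lt (hlt 1 (by norm_num))
  have a2 := Submodule.finrank_lt_finrank_of_lt (hlt 2 (by norm_num))
  have a3 := Submodule.finrank_lt_finrank_of_lt (hlt 3 (by norm_num))
  have a4 := Submodule.finrank_le (conjSpan v (S ^ 4))
  rw [Module.finrank_matrix] at a4
  simp only [Fintype.card_fin, Module.finrank_self, Nat.reduceAdd] at a4 a0 a1 a2 a3 h0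
  omega

variable [Fintype F] [DecidableEq F]

/-- Some conjugate of `v` by a short word is not orthogonal to many elements of `X`. -/
lemma exists_conj_card_le (h2 : (2 : F) ≠ 0) {S : Finset (SpecialLinearGroup (Fin 2) F)}
    (h1 : 1 ∈ S) (hinv : ∀ a ∈ S, a⁻¹ ∈ S)
    (hgen : Subgroup.closure (S : Set (SpecialLinearGroup (Fin 2) F)) = ⊤)
    {v : Matrix (Fin 2) (Fin 2) F} (hv : v ≠ 0) (hvt : v.trace = 0)
    {X : Finset (SpecialLinearGroup (Fin 2) F)}
    (hX : ∀ x ∈ X, ∀ c : F, (x : Matrix (Fin 2) (Fin 2) F) ≠ c • 1) :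
    ∃ g ∈ S ^ 3, X.card ≤ 4 * (X.filter fun x =>
      (v * ((g * x * g⁻¹ : SpecialLinearGroup (Fin 2) F) :
      Matrix (Fin 2) (Fin 2) F)).trace ≠ 0).card := by
  classical
  obtain ⟨i, hi, hW⟩ := exists_conjSpan_eq hv h1
  have hstep : ∀ a ∈ S, ∀ m ∈ conjSpan v (S ^ i),
      (a : Matrix (Fin 2) (Fin 2) F).adjugate * m * (a : Matrix (Fin 2) (Fin 2) F) ∈
        conjSpan v (S ^ i) := by
    intro a ha m hm
    rw [hW]
    exact conj_mem_conjSpan (fun g hg => by rw [pow_succ]; exact mul_mem_mul hg ha) hm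
  have hinvar : ∀ g : SpecialLinearGroup (Fin 2) F, ∀ m ∈ conjSpan v (S ^ i),
      (g : Matrix (Fin 2) (Fin 2) F) * m * (g : Matrix (Fin 2) (Fin 2) F).adjugate ∈
        conjSpan v (S ^ i) := by
    have key : ∀ g : SpecialLinearGroup (Fin 2) F, ∀ m ∈ conjSpan v (S ^ i),
        (g : Matrix (Fin 2) (Fin 2) F) * m * ((g⁻¹ : SpecialLinearGroup (Fin 2) F) :
          Matrix (Fin 2) (Fin 2) F) ∈ conjSpan v (S ^ i) ∧
        ((g⁻¹ : SpecialLinearGroup (Fin 2) F) : Matrix (Fin 2) (Fin 2) F) * m *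
          (g : Matrix (Fin 2) (Fin 2) F) ∈ conjSpan v (S ^ i) := by
      intro g
      have hg : g ∈ Subgroup.closure (S : Set (SpecialLinearGroup (Fin 2) F)) := by
        rw [hgen]; exact Subgroup.mem_top g
      induction hg using Subgroup.closure_induction with
      | mem a ha =>
        intro m hm
        have ha' := hstep _ (hinv a (by exact_mod_cast ha)) m hm
        rw [← Matrix.SpecialLinearGroup.coe_inv, inv_inv] at ha'
        refine ⟨ha', ?_⟩
        rw [Matrix.SpecialLinearGroup.coe_inv]
        exact hstep a (by exact_mod_cast ha) m hm
      | one => intro m hm; simpa using hm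
      | mul x y _ _ hx hy =>
        intro m hm
        rw [_root_.mul_inv_rev]
        simp only [Matrix.SpecialLinearGroup.coe_mul]
        constructor
        · have := (hx _ (hy m hm).1).1
          simpa only [mul_assoc] using this
        · have := (hy _ (hx m hm).2).2
          simpa only [mul_assoc] using this
      | inv x _ hx =>
        intro m hm
        rw [inv_inv]
        exact (hx m hm).symm
    intro g m hm
    rw [← Matrix.SpecialLinearGroup.coe_inv]
    exact (key g m hm).1
  have hvW : v ∈ conjSpan v (S ^ i) :=
    Submodule.subset_span ⟨1, by exact_mod_cast one_mem_pow h1, by simp⟩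
  have hsub : conjSpan v (S ^ i) ≤ conjSpan v (S ^ 3) :=
    conjSpan_mono v (pow_subset_pow_right h1 hi)
  -- The stable span is invariant under the whole group, so no non-central `x` is orthogonal to all
  -- of it. At most four conjugates form a basis of the span for `S ^ 3`, so one of them is
  -- non-orthogonal to a quarter of `X`.
  obtain ⟨b, hbT, hbspan, hbind⟩ := exists_linearIndependent F
    ((fun g : SpecialLinearGroup (Fin 2) F => (g : Matrix (Fin 2) (Fin 2) F).adjugate * v *
      (g : Matrix (Fin 2) (Fin 2) F)) '' (S ^ 3 : Finset (SpecialLinearGroup (Fin 2) F)))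
  have hbfin : b.Finite := Set.toFinite b
  have hbcard : hbfin.toFinset.card ≤ 4 := by
    have : Fintype b := hbfin.fintype
    have h := hbind.fintype_card_le_finrank
    rw [Module.finrank_matrix] at h
    rw [← Set.toFinset_card, ← Set.Finite.toFinset_eq_toFinset hbfin] at h
    simpa using h
  by_contra! hcon
  have hcover : X ⊆ hbfin.toFinset.biUnion
      (fun m => X.filter fun x : SpecialLinearGroup (Fin 2) F =>
        (m * (x : Matrix (Fin 2) (Fin 2) F)).trace ≠ 0) := by
    intro x hx
    simp only [mem_biUnion, Set.Finite.mem_toFinset, mem_filter]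
    by_contra! hall
    obtain ⟨m, hm, hne⟩ := exists_trace_mul_ne_zero h2 hinvar hvW hv hvt (hX x hx)
    apply hne
    have hm' : m ∈ Submodule.span F b := hbspan ▸ hsub hm
    have hle : Submodule.span F b ≤ LinearMap.ker
        ((traceLinearMap (Fin 2) F F).comp (LinearMap.mulRight F (x : Matrix (Fin 2) (Fin 2) F))) :=
      Submodule.span_le.2 fun m hm => by simpa using hall m hm hx
    simpa using hle hm'
  have hlt : ∀ m ∈ hbfin.toFinset,
      4 * (X.filter fun x : SpecialLinearGroup (Fin 2) F =>
        (m * (x : Matrix (Fin 2) (Fin 2) F)).trace ≠ 0).card < X.card := by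
    intro m hm
    obtain ⟨g, hg, rfl⟩ := hbT (hbfin.mem_toFinset.1 hm)
    refine lt_of_eq_of_lt ?_ (hcon g (by exact_mod_cast hg))
    congr 2
    refine filter_congr fun x _ => ?_
    rw [Matrix.SpecialLinearGroup.coe_mul, Matrix.SpecialLinearGroup.coe_mul,
      Matrix.SpecialLinearGroup.coe_inv, mul_assoc, mul_assoc, trace_mul_comm]
    simp only [mul_assoc]
  have hpos : 0 < X.card := by
    have := hcon 1 (one_mem_pow h1)
    omega
  have h4 := card_le_card hcover
  have h5 : (hbfin.toFinset.biUnion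
      (fun m => X.filter fun x : SpecialLinearGroup (Fin 2) F =>
        (m * (x : Matrix (Fin 2) (Fin 2) F)).trace ≠ 0)).card ≤
      hbfin.toFinset.card * ((X.card - 1) / 4) :=
    card_biUnion_le_card_mul _ _ _ fun m hm => by have := hlt m hm; omega
  have h6 := Nat.mul_le_mul_right ((X.card - 1) / 4) hbcard
  omega

end Spreading

/-! ### Growth inside a conjugacy class. -/

section ClassGrowth

open Matrix Finset
open scoped Pointwise

variable {F : Type*} [Field F]

lemma eq_or_eq_neg_of_coe_eq_smul {w : SpecialLinearGroup (Fin 2) F} {c : F}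
    (h : (w : Matrix (Fin 2) (Fin 2) F) = c • 1) : w = 1 ∨ w = -1 := by
  have hd := w.det_coe
  rw [h, det_smul, det_one, Fintype.card_fin, mul_one, sq_eq_one_iff] at hd
  rcases hd with rfl | rfl
  · left
    exact Subtype.ext (by simpa using h)
  · right
    exact Subtype.ext (by simpa using h)

variable [Fintype F] [DecidableEq F]

lemma card_filter_mul_scalar_le (X : Finset (SpecialLinearGroup (Fin 2) F)) :
    ((X ×ˢ X).filter fun q => ∃ c : F, ((q.1 * q.2 : SpecialLinearGroup (Fin 2) F) :
      Matrix (Fin 2) (Fin 2) F) = c • 1).card ≤ 2 * X.card := by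
  refine card_le_mul_card_image_of_maps_to (f := Prod.fst) (t := X) ?_ 2 ?_
  · intro q hq
    exact (mem_product.1 (mem_filter.1 hq).1).1
  · intro x hx
    have : (filter (fun q : SpecialLinearGroup (Fin 2) F × SpecialLinearGroup (Fin 2) F => q.1 = x)
        ((X ×ˢ X).filter fun q => ∃ c : F, ((q.1 * q.2 : SpecialLinearGroup (Fin 2) F) :
          Matrix (Fin 2) (Fin 2) F) = c • 1)) ⊆ {(x, x⁻¹), (x, -x⁻¹)} := by
      rintro ⟨a, b⟩ hq
      obtain ⟨hab, rfl⟩ := mem_filter.1 hq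
      have hc : ∃ c : F, ((a * b : SpecialLinearGroup (Fin 2) F) :
        Matrix (Fin 2) (Fin 2) F) = c • 1 := (mem_filter.1 hab).2
      obtain ⟨c, hc⟩ := hc
      rw [mem_insert, mem_singleton]
      rcases eq_or_eq_neg_of_coe_eq_smul hc with h | h
      · left
        rw [Prod.mk.injEq]
        exact ⟨rfl, (inv_eq_of_mul_eq_one_right h).symm⟩
      · right
        rw [Prod.mk.injEq]
        refine ⟨rfl, ?_⟩
        rw [← neg_eq_iff_eq_neg]
        refine (inv_eq_of_mul_eq_one_right ?_).symm
        change a * -b = 1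
        rw [mul_neg, h, neg_neg]
    exact (card_le_card this).trans card_le_two

/-- A pair with product `w` is determined by its first factor, which lies on the section `detPolar x
w = t`. Scalar `w` give no plane; they account for the term `2 * X.card`. -/
lemma card_sq_le_of_section_card_le {t : F} {X : Finset (SpecialLinearGroup (Fin 2) F)}
    (hXt : ∀ x ∈ X, (x : Matrix (Fin 2) (Fin 2) F).trace = t) {Q : ℕ}
    (hQ : ∀ w : SpecialLinearGroup (Fin 2) F, (∀ c : F, (w : Matrix (Fin 2) (Fin 2) F) ≠ c • 1) →
      (X.filter fun x : SpecialLinearGroup (Fin 2) F => detPolar (x : Matrix (Fin 2) (Fin 2) F)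
        (w : Matrix (Fin 2) (Fin 2) F) = t).card ≤ Q) :
    X.card * X.card ≤ 2 * X.card + Q * (X * X).card := by
  classical
  rw [← card_product, ← card_filter_add_card_filter_not (s := X ×ˢ X) fun q => ∃ c : F,
    ((q.1 * q.2 : SpecialLinearGroup (Fin 2) F) : Matrix (Fin 2) (Fin 2) F) = c • 1]
  refine add_le_add (card_filter_mul_scalar_le X) ?_
  refine card_le_mul_card_image_of_maps_to (f := fun q => q.1 * q.2) (t := X * X) ?_ Q ?_
  · intro q hq
    obtain ⟨h1, h2⟩ := mem_product.1 (mem_filter.1 hq).1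
    exact mul_mem_mul h1 h2
  · intro w _
    by_cases hw : ∃ c : F, (w : Matrix (Fin 2) (Fin 2) F) = c • 1
    · rw [card_eq_zero.2]
      · exact Nat.zero_le _
      · refine filter_eq_empty_iff.2 ?_
        rintro q hq rfl
        exact (mem_filter.1 hq).2 hw
    · push Not at hw
      refine le_trans ?_ (hQ w hw)
      refine card_le_card_of_injOn Prod.fst ?_ ?_
      · intro q hq
        obtain ⟨hq', rfl⟩ := mem_filter.1 hq
        obtain ⟨h1, h2⟩ := mem_product.1 (mem_filter.1 hq').1
        refine mem_coe.2 (mem_filter.2 ⟨h1, ?_⟩)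
        rw [detPolar_eq_trace_inv_mul, inv_mul_cancel_left, hXt _ h2]
      · intro q hq q' hq' h
        have h1 := (mem_filter.1 hq).2
        have h2 := (mem_filter.1 hq').2
        refine Prod.ext h ?_
        rw [← h2, h, mul_right_inj] at h1
        exact h1

/-- A conjugate of a large part of `X` avoids the plane orthogonal to `v`. -/
lemma exists_conj_avoiding (h2 : (2 : F) ≠ 0) {S : Finset (SpecialLinearGroup (Fin 2) F)}
    (h1 : 1 ∈ S) (hinv : ∀ a ∈ S, a⁻¹ ∈ S)
    (hgen : Subgroup.closure (S : Set (SpecialLinearGroup (Fin 2) F)) = ⊤)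
    {v : Matrix (Fin 2) (Fin 2) F} (hv : v ≠ 0) (hvt : v.trace = 0)
    {t : F} {X : Finset (SpecialLinearGroup (Fin 2) F)}
    (hXt : ∀ x ∈ X, (x : Matrix (Fin 2) (Fin 2) F).trace = t)
    (hX : ∀ x ∈ X, ∀ c : F, (x : Matrix (Fin 2) (Fin 2) F) ≠ c • 1) :
    ∃ Y : Finset (SpecialLinearGroup (Fin 2) F), X.card ≤ 4 * Y.card ∧
      (∀ y ∈ Y, (y : Matrix (Fin 2) (Fin 2) F).trace = t) ∧
      (∀ y ∈ Y, (v * (y : Matrix (Fin 2) (Fin 2) F)).trace ≠ 0) ∧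
      ∀ Z ⊆ X, (Z * Y).card ≤ (X * S ^ 3 * X).card := by
  obtain ⟨g, hg, hcard⟩ := exists_conj_card_le h2 h1 hinv hgen hv hvt hX
  set X' := X.filter fun x => (v * ((g * x * g⁻¹ : SpecialLinearGroup (Fin 2) F) :
      Matrix (Fin 2) (Fin 2) F)).trace ≠ 0 with hX'
  refine ⟨X'.image fun x => g * x * g⁻¹, ?_, ?_, ?_, ?_⟩
  · rwa [card_image_of_injective]
    intro x y h
    simpa using h
  · intro y hy
    obtain ⟨x, hx, rfl⟩ := mem_image.1 hy
    rw [Matrix.SpecialLinearGroup.coe_mul, trace_mul_comm, ← Matrix.SpecialLinearGroup.coe_mul,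
      inv_mul_cancel_left]
    exact hXt x (mem_filter.1 hx).1
  · intro y hy
    obtain ⟨x, hx, rfl⟩ := mem_image.1 hy
    exact (mem_filter.1 hx).2
  · intro Z hZ
    -- Right multiplication by `g` cancels the trailing `g⁻¹` of the conjugates and lands in `X * S
    -- ^ 3 * X`.
    refine card_le_card_of_injOn (fun w => w * g) ?_ (fun x _ y _ h => by simpa using h)
    intro w hw
    obtain ⟨z, hz, y, hy, rfl⟩ := mem_mul.1 (mem_coe.1 hw)
    obtain ⟨x, hx, rfl⟩ := mem_image.1 hy
    have e : z * (g * x * g⁻¹) * g = z * g * x := by group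
    refine mem_coe.2 ?_
    simp only [e]
    exact mul_mem_mul (mul_mem_mul (hZ hz) hg) (mem_filter.1 hx).1

/-- Growth of a set of non-central elements of fixed trace in a product with itself. -/
theorem card_pow_three_le_of_trace_eq (h2 : (2 : F) ≠ 0)
    {S : Finset (SpecialLinearGroup (Fin 2) F)} (h1 : 1 ∈ S) (hinv : ∀ a ∈ S, a⁻¹ ∈ S)
    (hgen : Subgroup.closure (S : Set (SpecialLinearGroup (Fin 2) F)) = ⊤)
    {t : F} {X : Finset (SpecialLinearGroup (Fin 2) F)}
    (hXt : ∀ x ∈ X, (x : Matrix (Fin 2) (Fin 2) F).trace = t)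
    (hX : ∀ x ∈ X, ∀ c : F, (x : Matrix (Fin 2) (Fin 2) F) ≠ c • 1) (hn : 16 ≤ X.card) :
    X.card ^ 3 ≤ 256 * (X * S ^ 3 * X).card ^ 2 := by
  classical
  by_cases hQ : ∀ w : SpecialLinearGroup (Fin 2) F,
      (∀ c : F, (w : Matrix (Fin 2) (Fin 2) F) ≠ c • 1) →
      (X.filter fun x : SpecialLinearGroup (Fin 2) F => detPolar (x : Matrix (Fin 2) (Fin 2) F)
        (w : Matrix (Fin 2) (Fin 2) F) = t).card ≤ Nat.sqrt X.card
  · have e := card_sq_le_of_section_card_le hXt hQ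
    have hsub : (X * X).card ≤ (X * S ^ 3 * X).card := by
      refine card_le_card (mul_subset_mul_right ?_)
      intro x hx
      simpa using mul_mem_mul hx (one_mem_pow h1 : (1 : SpecialLinearGroup (Fin 2) F) ∈ S ^ 3)
    have hs := Nat.sqrt_le' X.card
    generalize X.card = n at *
    generalize (X * S ^ 3 * X).card = P at *
    generalize (X * X).card = M at *
    generalize Nat.sqrt n = Q at *
    have e2 : n * n ≤ 2 * (Q * P) := by nlinarith
    have e3 : (n * n) ^ 2 ≤ (2 * (Q * P)) ^ 2 := Nat.pow_le_pow_left e2 2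
    have e4 : n * n ^ 3 ≤ n * (4 * P ^ 2) := by
      calc n * n ^ 3 = (n * n) ^ 2 := by ring
        _ ≤ (2 * (Q * P)) ^ 2 := e3
        _ = Q ^ 2 * (4 * P ^ 2) := by ring
        _ ≤ n * (4 * P ^ 2) := Nat.mul_le_mul_right _ hs
    have e5 := Nat.le_of_mul_le_mul_left e4 (by omega)
    nlinarith
  · push Not at hQ
    obtain ⟨w, hw, hcard⟩ := hQ
    set Z := X.filter fun x : SpecialLinearGroup (Fin 2) F =>
      detPolar (x : Matrix (Fin 2) (Fin 2) F) (w : Matrix (Fin 2) (Fin 2) F) = t with hZ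
    have hZX : Z ⊆ X := filter_subset _ _
    have hZt : ∀ z ∈ Z, (z : Matrix (Fin 2) (Fin 2) F).trace = t := fun z hz => hXt z (hZX hz)
    have hZw : ∀ z ∈ Z, detPolar (z : Matrix (Fin 2) (Fin 2) F) (w : Matrix (Fin 2) (Fin 2) F) =
        t := fun z hz => (mem_filter.1 hz).2
    -- Five points suffice for the error term `2 * Y.card` of the anisotropic estimate to be
    -- absorbed.
    have hZ5 : 5 ≤ Z.card := by
      have : 4 ≤ Nat.sqrt X.card := Nat.le_sqrt'.2 hn
      omega
    have hZn : X.card ≤ Z.card ^ 2 := (Nat.sqrt_lt'.1 hcard).le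
    suffices hP : Z.card * X.card ≤ 16 * (X * S ^ 3 * X).card by
      calc X.card ^ 3 = X.card * X.card ^ 2 := by ring
        _ ≤ Z.card ^ 2 * X.card ^ 2 := Nat.mul_le_mul_right _ hZn
        _ = (Z.card * X.card) ^ 2 := by ring
        _ ≤ (16 * (X * S ^ 3 * X).card) ^ 2 := Nat.pow_le_pow_left hP 2
        _ = 256 * (X * S ^ 3 * X).card ^ 2 := by ring
    by_cases hani : ∀ z ∈ Z, ∀ z' ∈ Z, z ≠ z' →
        ((z : Matrix (Fin 2) (Fin 2) F) - (z' : Matrix (Fin 2) (Fin 2) F)).det ≠ 0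
    -- Twice the traceless part of `w`; non-orthogonality to it is exactly the condition that
    -- `card_mul_card_le_of_anisotropic` asks of `Y`.
    · obtain ⟨Y, hY4, hYt, hYv, hYP⟩ := exists_conj_avoiding h2 h1 hinv hgen
        (v := (2 : F) • (w : Matrix (Fin 2) (Fin 2) F) -
          (w : Matrix (Fin 2) (Fin 2) F).trace • 1)
        (fun h => hw ((2 : F)⁻¹ * (w : Matrix (Fin 2) (Fin 2) F).trace) (by
          rw [mul_smul, eq_inv_smul_iff₀ h2]
          exact sub_eq_zero.1 h)) (by
          rw [trace_sub, trace_smul, trace_smul, trace_one, Fintype.card_fin]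
          simp only [smul_eq_mul]
          push_cast
          ring) hXt hX
      have := card_mul_card_le_of_anisotropic hw hZt hZw hani hYt (by
        intro y hy h
        apply hYv y hy
        rw [sub_mul, smul_mul_assoc, smul_mul_assoc, one_mul, trace_sub, trace_smul, trace_smul,
          smul_eq_mul, smul_eq_mul, h, sub_self])
      have h3 := hYP Z hZX
      nlinarith
    · push Not at hani
      obtain ⟨z₁, hz1, z₂, hz2, h12, hd⟩ := hani
      obtain ⟨Z', hZ', hhalf, z₀, n, hn0, hnt, hnd, hz0, hline⟩ :=
        exists_isotropic_half hw hZt hZw hz2 hz1 h12.symm hd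
      obtain ⟨Y, hY4, hYt, hYv, hYP⟩ := exists_conj_avoiding h2 h1 hinv hgen hn0 hnt hXt hX
      have := card_mul_card_eq_of_isotropic hn0 hnt hnd hz0 hline hYt hYv
      have h3 := hYP Z' (hZ'.trans hZX)
      nlinarith

end ClassGrowth

/-! ### Finding a regular semisimple element among short words. -/

section RegularSemisimple

open Matrix Finset
open scoped Pointwise

variable {F : Type*} [Field F]

lemma exists_eq_smul_one_of_commute {n : Matrix (Fin 2) (Fin 2) F}
    (h : ∀ g : SpecialLinearGroup (Fin 2) F, (g : Matrix (Fin 2) (Fin 2) F) * n =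
      n * (g : Matrix (Fin 2) (Fin 2) F)) : ∃ c : F, n = c • 1 := by
  have hu := h ⟨!![1, 1; 0, 1], by simp [det_fin_two]⟩
  have hl := h ⟨!![1, 0; 1, 1], by simp [det_fin_two]⟩
  have eu := fun i j => congrFun (congrFun hu i) j
  have el := fun i j => congrFun (congrFun hl i) j
  have e1 := eu 0 0
  have e2 := eu 0 1
  have e3 := el 0 0
  simp only [Matrix.mul_apply, Fin.sum_univ_two, of_apply, cons_val',
    cons_val_zero, cons_val_one, cons_val_fin_one] at e1 e2 e3
  refine ⟨n 0 0, matrix_fin_two_ext ?_ ?_ ?_ ?_⟩ <;> simp only [Matrix.smul_apply, smul_eq_mul]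
  · simp
  · simp
    linear_combination -e3
  · simp
    linear_combination e1
  · simp
    linear_combination e2

lemma forall_commute_of_generators {S : Finset (SpecialLinearGroup (Fin 2) F)}
    (hgen : Subgroup.closure (S : Set (SpecialLinearGroup (Fin 2) F)) = ⊤)
    {n : Matrix (Fin 2) (Fin 2) F}
    (h : ∀ a ∈ S, (a : Matrix (Fin 2) (Fin 2) F) * n = n * (a : Matrix (Fin 2) (Fin 2) F))
    (g : SpecialLinearGroup (Fin 2) F) :
    (g : Matrix (Fin 2) (Fin 2) F) * n = n * (g : Matrix (Fin 2) (Fin 2) F) := by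
  have hg : g ∈ Subgroup.closure (S : Set (SpecialLinearGroup (Fin 2) F)) := by
    rw [hgen]; exact Subgroup.mem_top g
  induction hg using Subgroup.closure_induction with
  | mem a ha => exact h a (mem_coe.1 ha)
  | one => simp
  | mul x y _ _ hx hy =>
    rw [Matrix.SpecialLinearGroup.coe_mul, mul_assoc, hy, ← mul_assoc, hx, mul_assoc]
  | inv x _ hx =>
    have e1 : ((x⁻¹ : SpecialLinearGroup (Fin 2) F) : Matrix (Fin 2) (Fin 2) F) *
        (x : Matrix (Fin 2) (Fin 2) F) = 1 := by
      rw [← Matrix.SpecialLinearGroup.coe_mul, inv_mul_cancel, Matrix.SpecialLinearGroup.coe_one]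
    have e2 : (x : Matrix (Fin 2) (Fin 2) F) *
        ((x⁻¹ : SpecialLinearGroup (Fin 2) F) : Matrix (Fin 2) (Fin 2) F) = 1 := by
      rw [← Matrix.SpecialLinearGroup.coe_mul, mul_inv_cancel, Matrix.SpecialLinearGroup.coe_one]
    calc _ = ((x⁻¹ : SpecialLinearGroup (Fin 2) F) : Matrix (Fin 2) (Fin 2) F) *
          (n * (x : Matrix (Fin 2) (Fin 2) F)) *
          ((x⁻¹ : SpecialLinearGroup (Fin 2) F) : Matrix (Fin 2) (Fin 2) F) := by
            simp only [mul_assoc, e2, mul_one]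
      _ = _ := by rw [← hx, ← mul_assoc, e1, one_mul]

lemma exists_nilpotent_part (h2 : (2 : F) ≠ 0) {a : SpecialLinearGroup (Fin 2) F}
    (ha : (a : Matrix (Fin 2) (Fin 2) F).trace ^ 2 = 4) :
    ∃ (ε : F) (n : Matrix (Fin 2) (Fin 2) F), ε ^ 2 = 1 ∧ n.trace = 0 ∧ n.det = 0 ∧
      (a : Matrix (Fin 2) (Fin 2) F) = ε • (1 + n) := by
  have hd := a.det_coe
  set m := (a : Matrix (Fin 2) (Fin 2) F)
  obtain ⟨ε, hε⟩ : ∃ ε : F, m.trace = 2 * ε := ⟨m.trace / 2, by field_simp⟩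
  have hε1 : ε ^ 2 = 1 := by
    rw [hε] at ha
    have : (2 * 2 : F) * ε ^ 2 = 2 * 2 * 1 := by linear_combination ha
    exact mul_left_cancel₀ (mul_ne_zero h2 h2) this
  refine ⟨ε, ε • m - 1, hε1, ?_, ?_, ?_⟩
  · rw [trace_sub, trace_smul, hε, trace_one, Fintype.card_fin, smul_eq_mul]
    push_cast
    linear_combination 2 * hε1
  · rw [trace_fin_two] at hε
    rw [det_fin_two] at hd ⊢
    simp only [Matrix.sub_apply, Matrix.smul_apply, smul_eq_mul, Matrix.one_apply]
    simp
    linear_combination ε ^ 2 * hd - ε * hε - hε1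
  · rw [add_sub_cancel, smul_smul, ← sq, hε1, one_smul]

/-- With `τ = tr (n * m)` the two traces are `±(2 + τ)` and `±(2 - τ)`; both squares being 4 forces
`8 * τ = 0`. -/
lemma detPolar_eq_zero_of_trace_sq (h2 : (2 : F) ≠ 0) {ε δ : F}
    {n m : Matrix (Fin 2) (Fin 2) F} (hε : ε ^ 2 = 1) (hδ : δ ^ 2 = 1) (hn : n.trace = 0)
    (hm : m.trace = 0) (h1 : ((ε • (1 + n)) * (δ • (1 + m))).trace ^ 2 = 4)
    (h1' : ((ε • (1 + n)) * (δ • (1 - m))).trace ^ 2 = 4) : detPolar n m = 0 := by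
  have hτ : detPolar n m = -(n * m).trace := by
    rw [trace_fin_two] at hn hm
    simp only [detPolar, trace_fin_two, Matrix.mul_apply, Fin.sum_univ_two]
    linear_combination (n 0 0 + n 1 1) * hm
  have e1 : ((ε • (1 + n)) * (δ • (1 + m))).trace = ε * δ * (2 + (n * m).trace) := by
    rw [smul_mul_smul_comm, trace_smul, add_mul, mul_add, mul_add]
    simp only [one_mul, mul_one, trace_add, hn, hm, trace_one, Fintype.card_fin, smul_eq_mul]
    push_cast
    ring
  have e2 : ((ε • (1 + n)) * (δ • (1 - m))).trace = ε * δ * (2 - (n * m).trace) := by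
    rw [smul_mul_smul_comm, trace_smul, add_mul, mul_sub, mul_sub]
    simp only [one_mul, mul_one, trace_add, trace_sub, hn, hm, trace_one, Fintype.card_fin,
      smul_eq_mul]
    push_cast
    ring
  rw [e1] at h1
  rw [e2] at h1'
  rw [hτ]
  have : (2 * 2 * 2 : F) * (n * m).trace = 0 := by
    linear_combination h1 - h1' - (8 * (n * m).trace) * (hε * δ ^ 2 + hδ)
  rw [(mul_eq_zero.1 this).resolve_left (mul_ne_zero (mul_ne_zero h2 h2) h2), neg_zero]

/-- A generating set of `SL₂` has an element of trace other than `±2` among its products. -/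
lemma exists_trace_sq_ne_four (h2 : (2 : F) ≠ 0) [DecidableEq F]
    {S : Finset (SpecialLinearGroup (Fin 2) F)}
    (h1 : 1 ∈ S) (hinv : ∀ a ∈ S, a⁻¹ ∈ S)
    (hgen : Subgroup.closure (S : Set (SpecialLinearGroup (Fin 2) F)) = ⊤) :
    ∃ h ∈ S ^ 2, (h : Matrix (Fin 2) (Fin 2) F).trace ^ 2 ≠ 4 := by
  by_contra! hcon
  have hS : ∀ a ∈ S, (a : Matrix (Fin 2) (Fin 2) F).trace ^ 2 = 4 := fun a ha =>
    hcon a (by simpa [sq] using mul_mem_mul ha h1)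
  have hSS : ∀ a ∈ S, ∀ b ∈ S, ((a : Matrix (Fin 2) (Fin 2) F) *
      (b : Matrix (Fin 2) (Fin 2) F)).trace ^ 2 = 4 := fun a ha b hb => by
    rw [← Matrix.SpecialLinearGroup.coe_mul]
    exact hcon _ (by rw [sq]; exact mul_mem_mul ha hb)
  -- If all traces are `±2`, every element of `S` is `±(1 + nilpotent)`. The traces of `a * b` and
  -- `a * b⁻¹` make the nilpotent parts orthogonal, hence proportional, so `S` and then the whole
  -- group commute with one nonzero traceless matrix.
  obtain ⟨n, hn0, hnt, hn⟩ : ∃ n : Matrix (Fin 2) (Fin 2) F, n ≠ 0 ∧ n.trace = 0 ∧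
      ∀ a ∈ S, (a : Matrix (Fin 2) (Fin 2) F) * n = n * (a : Matrix (Fin 2) (Fin 2) F) := by
    by_cases hsc : ∀ a ∈ S, ∃ c : F, (a : Matrix (Fin 2) (Fin 2) F) = c • 1
    · refine ⟨!![0, 1; 0, 0], fun h => ?_, by simp [trace_fin_two], fun a ha => ?_⟩
      · simpa using congrFun (congrFun h 0) 1
      · obtain ⟨c, hc⟩ := hsc a ha
        rw [hc, smul_mul_assoc, mul_smul_comm, one_mul, mul_one]
    · push Not at hsc
      obtain ⟨a, ha, hac⟩ := hsc
      obtain ⟨ε, n, hε, hnt, hnd, han⟩ := exists_nilpotent_part h2 (hS a ha)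
      have hn0 : n ≠ 0 := by
        rintro rfl
        exact hac ε (by rw [han, add_zero])
      refine ⟨n, hn0, hnt, fun b hb => ?_⟩
      obtain ⟨δ, m, hδ, hmt, hmd, hbm⟩ := exists_nilpotent_part h2 (hS b hb)
      have hbinv : ((b⁻¹ : SpecialLinearGroup (Fin 2) F) : Matrix (Fin 2) (Fin 2) F) =
          δ • (1 - m) := by
        rw [Matrix.SpecialLinearGroup.coe_inv, hbm, adjugate_fin_two]
        rw [trace_fin_two] at hmt
        refine matrix_fin_two_ext ?_ ?_ ?_ ?_ <;>
          simp only [of_apply, cons_val', cons_val_zero, cons_val_one, cons_val_fin_one,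
            Matrix.smul_apply, Matrix.add_apply, Matrix.sub_apply, smul_eq_mul] <;>
          simp
        · exact Or.inl (by linear_combination hmt)
        · exact Or.inl (by linear_combination hmt)
      obtain ⟨s, rfl⟩ := eq_smul_of_isotropic hn0 hnt hmt hnd hmd
        (detPolar_eq_zero_of_trace_sq h2 hε hδ hnt hmt (by rw [← han, ← hbm]; exact hSS a ha b hb)
          (by rw [← han, ← hbinv]; exact hSS a ha _ (hinv b hb)))
      rw [hbm, smul_mul_assoc, mul_smul_comm, add_mul, mul_add, one_mul, mul_one, smul_mul_assoc,
        mul_smul_comm]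
  obtain ⟨c, rfl⟩ := exists_eq_smul_one_of_commute (forall_commute_of_generators hgen hn)
  rw [trace_smul, trace_one, Fintype.card_fin, smul_eq_mul] at hnt
  have hc : c = 0 := (mul_eq_zero.1 hnt).resolve_right (by exact_mod_cast h2)
  exact hn0 (by rw [hc, zero_smul])

end RegularSemisimple

/-! ### Sizes of centralizers. -/

section Centralizers

open Matrix Finset
open scoped Pointwise

variable {F : Type*} [Field F]

/-- The centralizer of a non-central `h` lies in the commutative algebra spanned by `1` and `h`. -/
lemma mul_comm_of_commute_noncentral {x y h : SpecialLinearGroup (Fin 2) F}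
    (hh : ∀ c : F, (h : Matrix (Fin 2) (Fin 2) F) ≠ c • 1) (hx : x * h = h * x)
    (hy : y * h = h * y) : x * y = y * x := by
  have key : ∀ z : SpecialLinearGroup (Fin 2) F, z * h = h * z → ∃ a b : F,
      (z : Matrix (Fin 2) (Fin 2) F) = a • 1 + b • (h : Matrix (Fin 2) (Fin 2) F) := by
    intro z hz
    refine mem_span_one_of_commute hh ?_
    rw [← Matrix.SpecialLinearGroup.coe_mul, hz, Matrix.SpecialLinearGroup.coe_mul]
  obtain ⟨a, b, e⟩ := key x hx
  obtain ⟨c, d, e'⟩ := key y hy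
  refine Subtype.ext ?_
  change (x : Matrix (Fin 2) (Fin 2) F) * (y : Matrix (Fin 2) (Fin 2) F) =
    (y : Matrix (Fin 2) (Fin 2) F) * (x : Matrix (Fin 2) (Fin 2) F)
  rw [e, e']
  simp only [add_mul, mul_add, smul_mul_assoc, mul_smul_comm, one_mul, mul_one, smul_add,
    smul_comm d, smul_comm c]
  abel

lemma ne_smul_one_of_trace_sq_ne {h : SpecialLinearGroup (Fin 2) F}
    (hh : (h : Matrix (Fin 2) (Fin 2) F).trace ^ 2 ≠ 4) (c : F) :
    (h : Matrix (Fin 2) (Fin 2) F) ≠ c • 1 := by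
  intro hc
  have hd := h.det_coe
  rw [hc, det_smul, det_one, Fintype.card_fin, mul_one] at hd
  rw [hc, trace_smul, trace_one, Fintype.card_fin, smul_eq_mul] at hh
  push_cast at hh
  exact hh (by linear_combination 4 * hd)

lemma conj_ne_smul_one {h : SpecialLinearGroup (Fin 2) F}
    (hh : ∀ c : F, (h : Matrix (Fin 2) (Fin 2) F) ≠ c • 1) (g : SpecialLinearGroup (Fin 2) F)
    (c : F) : ((g * h * g⁻¹ : SpecialLinearGroup (Fin 2) F) : Matrix (Fin 2) (Fin 2) F) ≠
      c • 1 := by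
  intro hc
  have e : h = g⁻¹ * (g * h * g⁻¹) * g := by group
  apply hh c
  rw [e, Matrix.SpecialLinearGroup.coe_mul, Matrix.SpecialLinearGroup.coe_mul, hc,
    mul_smul_comm, smul_mul_assoc, mul_one, ← Matrix.SpecialLinearGroup.coe_mul, inv_mul_cancel,
    Matrix.SpecialLinearGroup.coe_one]

lemma card_filter_quadratic_le_two [Fintype F] [DecidableEq F] (b c : F) :
    (univ.filter fun x : F => x ^ 2 + b * x + c = 0).card ≤ 2 := by
  by_contra! hcard
  obtain ⟨x, hx, y, hy, z, hz, hxy, hxz, hyz⟩ := two_lt_card.1 hcard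
  simp only [mem_filter, mem_univ, true_and] at hx hy hz
  have e1 : x + y + b = 0 := by
    refine mul_left_cancel₀ (sub_ne_zero.2 hxy) ?_
    linear_combination hx - hy
  have e2 : x + z + b = 0 := by
    refine mul_left_cancel₀ (sub_ne_zero.2 hxz) ?_
    linear_combination hx - hz
  exact hyz (by linear_combination e1 - e2)

variable [Fintype F] [DecidableEq F]

/-- An element `a • 1 + b • h` has determinant one only if `a` solves a monic quadratic depending on
`b`. -/
lemma card_commute_le {h : SpecialLinearGroup (Fin 2) F}
    (hh : ∀ c : F, (h : Matrix (Fin 2) (Fin 2) F) ≠ c • 1) :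
    (univ.filter fun y : SpecialLinearGroup (Fin 2) F => y * h = h * y).card ≤
      2 * Fintype.card F := by
  let T : Finset (F × F) := univ.filter fun q => q.1 ^ 2 + (q.2 *
    (h : Matrix (Fin 2) (Fin 2) F).trace) * q.1 + (q.2 ^ 2 - 1) = 0
  have hT : T.card ≤ 2 * Fintype.card F := by
    refine card_le_mul_card_image_of_maps_to (f := Prod.snd) (t := univ) (fun _ _ => mem_univ _)
      2 fun β _ => ?_
    refine le_trans ?_ (card_filter_quadratic_le_two
      (β * (h : Matrix (Fin 2) (Fin 2) F).trace) (β ^ 2 - 1))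
    refine card_le_card_of_injOn Prod.fst ?_ ?_
    · intro q hq
      obtain ⟨hq', rfl⟩ := mem_filter.1 hq
      exact mem_coe.2 (mem_filter.2 ⟨mem_univ _, (mem_filter.1 hq').2⟩)
    · intro q hq q' hq' e
      exact Prod.ext e ((mem_filter.1 hq).2.trans (mem_filter.1 hq').2.symm)
  refine le_trans ?_ hT
  refine le_trans ?_ (card_image_le (s := T) (f := fun q => q.1 • (1 : Matrix (Fin 2) (Fin 2) F) +
    q.2 • (h : Matrix (Fin 2) (Fin 2) F)))
  refine card_le_card_of_injOn (fun y => (y : Matrix (Fin 2) (Fin 2) F)) ?_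
    (Subtype.val_injective.injOn)
  intro y hy
  have hy := (mem_filter.1 hy).2
  obtain ⟨a, b, e⟩ := mem_span_one_of_commute (w := (y : Matrix (Fin 2) (Fin 2) F)) hh (by
    rw [← Matrix.SpecialLinearGroup.coe_mul, hy, Matrix.SpecialLinearGroup.coe_mul])
  refine mem_coe.2 (mem_image.2 ⟨(a, b), mem_filter.2 ⟨mem_univ _, ?_⟩, e.symm⟩)
  have hyd := y.det_coe
  have hhd := h.det_coe
  rw [e, det_add_smul, det_smul, det_one, hhd, Fintype.card_fin] at hyd
  have : detPolar (a • (1 : Matrix (Fin 2) (Fin 2) F)) (h : Matrix (Fin 2) (Fin 2) F) =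
      a * (h : Matrix (Fin 2) (Fin 2) F).trace := by
    simp [detPolar, trace_fin_two]
    ring
  rw [this] at hyd
  simp only
  linear_combination hyd

/-- Comparing discriminants of `x = a • 1 + b • y` and `y` gives `b ^ 2 * (4 - T ^ 2) = 4 - t ^ 2 ≠
0`, so `b` is determined up to sign, and then `a` by the trace. -/
lemma card_commute_trace_le_two (h2 : (2 : F) ≠ 0) {t : F} (ht : t ^ 2 ≠ 4)
    {y : SpecialLinearGroup (Fin 2) F}
    (hy : ∀ c : F, (y : Matrix (Fin 2) (Fin 2) F) ≠ c • 1) :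
    (univ.filter fun x : SpecialLinearGroup (Fin 2) F =>
      x * y = y * x ∧ (x : Matrix (Fin 2) (Fin 2) F).trace = t).card ≤ 2 := by
  have hyd := y.det_coe
  set T := (y : Matrix (Fin 2) (Fin 2) F).trace with hTdef
  have key : ∀ x : SpecialLinearGroup (Fin 2) F, x * y = y * x →
      (x : Matrix (Fin 2) (Fin 2) F).trace = t → ∃ a b : F,
      (x : Matrix (Fin 2) (Fin 2) F) = a • 1 + b • (y : Matrix (Fin 2) (Fin 2) F) ∧
      2 * a = t - b * T ∧ b ^ 2 * (4 - T ^ 2) = 4 - t ^ 2 := by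
    intro x hxy hxt
    obtain ⟨a, b, e⟩ := mem_span_one_of_commute (w := (x : Matrix (Fin 2) (Fin 2) F)) hy (by
      rw [← Matrix.SpecialLinearGroup.coe_mul, hxy, Matrix.SpecialLinearGroup.coe_mul])
    have hxd := x.det_coe
    rw [e, det_add_smul, det_smul, det_one, hyd, Fintype.card_fin] at hxd
    have : detPolar (a • (1 : Matrix (Fin 2) (Fin 2) F)) (y : Matrix (Fin 2) (Fin 2) F) =
        a * T := by
      simp [detPolar, hTdef, trace_fin_two]
      ring
    rw [this] at hxd
    rw [e, trace_add, trace_smul, trace_smul, trace_one, Fintype.card_fin, smul_eq_mul,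
      smul_eq_mul] at hxt
    push_cast at hxt
    have h2a : 2 * a = t - b * T := by linear_combination hxt
    refine ⟨a, b, e, h2a, ?_⟩
    linear_combination 4 * hxd - (2 * a + t + b * T) * h2a
  by_contra! hcard
  obtain ⟨x₁, hx1, x₂, hx2, x₃, hx3, h12, h13, h23⟩ := two_lt_card.1 hcard
  simp only [mem_filter, mem_univ, true_and] at hx1 hx2 hx3
  obtain ⟨a₁, b₁, e1, f1, g1⟩ := key x₁ hx1.1 hx1.2
  obtain ⟨a₂, b₂, e2, f2, g2⟩ := key x₂ hx2.1 hx2.2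
  obtain ⟨a₃, b₃, e3, f3, g3⟩ := key x₃ hx3.1 hx3.2
  have hT : 4 - T ^ 2 ≠ 0 := by
    intro h
    rw [h, mul_zero] at g1
    exact ht (by linear_combination g1)
  have hab : ∀ (x x' : SpecialLinearGroup (Fin 2) F) (a b a' b' : F),
      (x : Matrix (Fin 2) (Fin 2) F) = a • 1 + b • (y : Matrix (Fin 2) (Fin 2) F) →
      (x' : Matrix (Fin 2) (Fin 2) F) = a' • 1 + b' • (y : Matrix (Fin 2) (Fin 2) F) →
      2 * a = t - b * T → 2 * a' = t - b' * T → b = b' → x = x' := by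
    intro x x' a b a' b' e e' f f' hb
    subst hb
    have : a = a' := mul_left_cancel₀ h2 (f.trans f'.symm)
    exact Subtype.ext (by rw [e, e', this])
  have hsq : ∀ b b' : F, b ^ 2 * (4 - T ^ 2) = 4 - t ^ 2 → b' ^ 2 * (4 - T ^ 2) = 4 - t ^ 2 →
      b ≠ b' → b + b' = 0 := by
    intro b b' g g' hb
    refine mul_left_cancel₀ (mul_ne_zero hT (sub_ne_zero.2 hb)) ?_
    linear_combination g - g'
  have s1 := hsq b₁ b₂ g1 g2 fun h => h12 (hab _ _ _ _ _ _ e1 e2 f1 f2 h)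
  have s2 := hsq b₁ b₃ g1 g3 fun h => h13 (hab _ _ _ _ _ _ e1 e3 f1 f3 h)
  exact h23 (hab _ _ _ _ _ _ e2 e3 f2 f3 (by linear_combination s1 - s2))

/-- A non-central element commutes with few conjugates of a regular semisimple element. -/
lemma card_commute_conj_le (h2 : (2 : F) ≠ 0) {h y : SpecialLinearGroup (Fin 2) F}
    (hh : (h : Matrix (Fin 2) (Fin 2) F).trace ^ 2 ≠ 4)
    (hy : ∀ c : F, (y : Matrix (Fin 2) (Fin 2) F) ≠ c • 1) :
    (univ.filter fun g : SpecialLinearGroup (Fin 2) F =>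
      y * (g * h * g⁻¹) = g * h * g⁻¹ * y).card ≤ 4 * Fintype.card F := by
  have hhc := ne_smul_one_of_trace_sq_ne hh
  -- At most two conjugates of `h` commute with `y`, and each arises from a coset of the centralizer
  -- of `h`.
  have h4 : 4 * Fintype.card F = 2 * Fintype.card F * 2 := by ring
  rw [h4]
  refine le_trans ?_ (Nat.mul_le_mul_left _ (card_commute_trace_le_two h2 hh hy))
  refine card_le_mul_card_image_of_maps_to (f := fun g => g * h * g⁻¹) ?_ _ ?_
  · intro g hg
    refine mem_filter.2 ⟨mem_univ _, (mem_filter.1 hg).2.symm, ?_⟩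
    rw [Matrix.SpecialLinearGroup.coe_mul, trace_mul_comm, ← Matrix.SpecialLinearGroup.coe_mul,
      inv_mul_cancel_left]
  · intro x _
    rcases eq_empty_or_nonempty (filter (fun g : SpecialLinearGroup (Fin 2) F => g * h * g⁻¹ = x)
      (univ.filter fun g : SpecialLinearGroup (Fin 2) F =>
        y * (g * h * g⁻¹) = g * h * g⁻¹ * y)) with he | ⟨g₀, hg₀⟩
    · rw [he, card_empty]
      exact Nat.zero_le _
    · refine le_trans ?_ (card_commute_le hhc)
      refine card_le_card_of_injOn (fun g => g₀⁻¹ * g) ?_ (fun a _ b _ e => by simpa using e)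
      intro g hg
      refine mem_coe.2 (mem_filter.2 ⟨mem_univ _, ?_⟩)
      have e : g * h * g⁻¹ = g₀ * h * g₀⁻¹ := (mem_filter.1 hg).2.trans (mem_filter.1 hg₀).2.symm
      calc g₀⁻¹ * g * h = g₀⁻¹ * (g * h * g⁻¹) * g := by group
        _ = h * (g₀⁻¹ * g) := by rw [e]; group

end Centralizers

/-! ### Growth of powers of a generating set. -/

section Growth

open Matrix Finset
open scoped Pointwise

variable {F : Type*} [Field F] [Fintype F] [DecidableEq F]

lemma mem_pow_inv {G : Type*} [Group G] [DecidableEq G] {E : Finset G}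
    (hinv : ∀ a ∈ E, a⁻¹ ∈ E) (m : ℕ) {b : G} (hb : b ∈ E ^ m) : b⁻¹ ∈ E ^ m := by
  have hE : E⁻¹ = E := by
    ext x
    rw [mem_inv']
    exact ⟨fun hx => by simpa using hinv _ hx, fun hx => hinv _ hx⟩
  rw [← hE, inv_pow, mem_inv', inv_inv]
  exact hb

lemma card_filter_scalar_le_two (T : Finset (SpecialLinearGroup (Fin 2) F)) :
    (T.filter fun y : SpecialLinearGroup (Fin 2) F =>
      ∃ c : F, (y : Matrix (Fin 2) (Fin 2) F) = c • 1).card ≤ 2 := by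
  refine (card_le_card (t := {1, -1}) ?_).trans card_le_two
  intro y hy
  obtain ⟨c, hc⟩ := (mem_filter.1 hy).2
  rw [mem_insert, mem_singleton]
  exact eq_or_eq_neg_of_coe_eq_smul hc

/-- Averaging over `g`: each non-central element of `T` commutes with `g * h * g⁻¹` for at most `4 *
Fintype.card F` choices of `g`, and there are at most two central elements. -/
lemma exists_conj_card_commute_le (h2 : (2 : F) ≠ 0) {h : SpecialLinearGroup (Fin 2) F}
    (hh : (h : Matrix (Fin 2) (Fin 2) F).trace ^ 2 ≠ 4)
    (T : Finset (SpecialLinearGroup (Fin 2) F)) :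
    ∃ g : SpecialLinearGroup (Fin 2) F,
      (T.filter fun y => y * (g * h * g⁻¹) = g * h * g⁻¹ * y).card *
        Nat.card (SpecialLinearGroup (Fin 2) F) ≤
      2 * Nat.card (SpecialLinearGroup (Fin 2) F) + 4 * Fintype.card F * T.card := by
  classical
  let T' := T.filter fun y : SpecialLinearGroup (Fin 2) F =>
      ¬ ∃ c : F, (y : Matrix (Fin 2) (Fin 2) F) = c • 1
  have hsplit : ∀ g : SpecialLinearGroup (Fin 2) F,
      (T.filter fun y => y * (g * h * g⁻¹) = g * h * g⁻¹ * y).card ≤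
      2 + (T'.filter fun y => y * (g * h * g⁻¹) = g * h * g⁻¹ * y).card := by
    intro g
    rw [← card_filter_add_card_filter_not
      (s := T.filter fun y => y * (g * h * g⁻¹) = g * h * g⁻¹ * y)
      fun y : SpecialLinearGroup (Fin 2) F => ∃ c : F, (y : Matrix (Fin 2) (Fin 2) F) = c • 1]
    refine add_le_add (card_filter_scalar_le_two _) (le_of_eq ?_)
    rw [filter_filter, filter_filter]
    congr 1
    exact filter_congr fun _ _ => and_comm
  have hsum : ∑ g : SpecialLinearGroup (Fin 2) F,
      (T'.filter fun y => y * (g * h * g⁻¹) = g * h * g⁻¹ * y).card ≤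
      T.card * (4 * Fintype.card F) := by
    have e := sum_card_bipartiteAbove_eq_sum_card_bipartiteBelow
      (s := (univ : Finset (SpecialLinearGroup (Fin 2) F))) (t := T')
      (fun g y => y * (g * h * g⁻¹) = g * h * g⁻¹ * y)
    simp only [bipartiteAbove, bipartiteBelow] at e
    rw [e]
    refine (sum_le_card_nsmul _ _ (4 * Fintype.card F) ?_).trans ?_
    · intro y hy
      refine card_commute_conj_le h2 hh fun c hc => (mem_filter.1 hy).2 ⟨c, hc⟩
    · rw [smul_eq_mul]
      exact Nat.mul_le_mul_right _ (card_filter_le _ _)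
  obtain ⟨g, -, hg⟩ := exists_min_image (univ : Finset (SpecialLinearGroup (Fin 2) F))
    (fun g => (T'.filter fun y => y * (g * h * g⁻¹) = g * h * g⁻¹ * y).card) ⟨1, mem_univ _⟩
  refine ⟨g, ?_⟩
  have h3 := card_nsmul_le_sum univ
    (fun g => (T'.filter fun y => y * (g * h * g⁻¹) = g * h * g⁻¹ * y).card) _ hg
  rw [smul_eq_mul, card_univ, ← Nat.card_eq_fintype_card] at h3
  have h4 := Nat.mul_le_mul_right (Nat.card (SpecialLinearGroup (Fin 2) F)) (hsplit g)
  linarith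

/-- Among the products of elements of `S` there is one which commutes with few of them. -/
lemma exists_card_commute_le (h2 : (2 : F) ≠ 0) {S : Finset (SpecialLinearGroup (Fin 2) F)}
    (h1 : 1 ∈ S) (hinv : ∀ a ∈ S, a⁻¹ ∈ S)
    (hgen : Subgroup.closure (S : Set (SpecialLinearGroup (Fin 2) F)) = ⊤) {k : ℕ} (hk : 1 ≤ k) :
    ∃ h ∈ S ^ (2 * k + 2), (∀ c : F, (h : Matrix (Fin 2) (Fin 2) F) ≠ c • 1) ∧
      ((S ^ (2 * k)).filter fun y => y * h = h * y).card *
        Nat.card (SpecialLinearGroup (Fin 2) F) ≤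
      2 * Nat.card (SpecialLinearGroup (Fin 2) F) + 4 * Fintype.card F * (S ^ (2 * k)).card := by
  classical
  obtain ⟨h₀, hh₀, htr⟩ := exists_trace_sq_ne_four h2 h1 hinv hgen
  have hnc := ne_smul_one_of_trace_sq_ne htr
  -- `P g` says that the torus centralizing `g * h₀ * g⁻¹` contains a non-central element of `S ^ (2
  -- * k)`.
  let P : SpecialLinearGroup (Fin 2) F → Prop := fun g => ∃ y ∈ S ^ (2 * k),
    (∀ c : F, (y : Matrix (Fin 2) (Fin 2) F) ≠ c • 1) ∧ y * (g * h₀ * g⁻¹) = g * h₀ * g⁻¹ * y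
  by_cases hP : ∀ g, P g
  -- Every torus is hit, so take `h` in one that meets `S ^ (2 * k)` no more than average; the
  -- centralizer of `h` lies in that torus.
  · obtain ⟨g, hg⟩ := exists_conj_card_commute_le h2 htr (S ^ (2 * k))
    obtain ⟨h, hhS, hhc, hcomm⟩ := hP g
    refine ⟨h, pow_subset_pow_right h1 (by omega) hhS, hhc, le_trans ?_ hg⟩
    refine Nat.mul_le_mul_right _ (card_le_card ?_)
    intro y hy
    obtain ⟨hyS, hyh⟩ := mem_filter.1 hy
    exact mem_filter.2 ⟨hyS, mul_comm_of_commute_noncentral hhc hyh hcomm.symm⟩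
  -- Some torus is missed while the one for `1` is hit, so a generator `a` carries a hit torus to a
  -- missed one. Conjugating a non-central `y` of the former by `a` gives an element commuting only
  -- with central elements of `S ^ (2 * k)`.
  · have hP1 : P 1 := ⟨h₀, pow_subset_pow_right h1 (by omega) hh₀, hnc, by group⟩
    obtain ⟨g, a, ha, hg, hag⟩ : ∃ g, ∃ a ∈ S, P g ∧ ¬ P (a * g) := by
      by_contra! hcon
      apply hP
      have hall : ∀ x : SpecialLinearGroup (Fin 2) F, ∀ g, P g → P (x * g) := by
        intro x
        have hx : x ∈ Subgroup.closure (S : Set (SpecialLinearGroup (Fin 2) F)) := by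
          rw [hgen]; exact Subgroup.mem_top x
        induction hx using Subgroup.closure_induction'' with
        | mem a ha => exact fun g hg => hcon g a (mem_coe.1 ha) hg
        | inv_mem a ha => exact fun g hg => hcon g _ (hinv a (mem_coe.1 ha)) hg
        | one => intro g hg; rwa [one_mul]
        | mul x y _ _ hx hy => intro g hg; rw [mul_assoc]; exact hx _ (hy _ hg)
      intro g
      simpa using hall g 1 hP1
    obtain ⟨y, hy, hyc, hcomm⟩ := hg
    refine ⟨a * y * a⁻¹, ?_, conj_ne_smul_one hyc a, ?_⟩
    · have : a * y * a⁻¹ ∈ S * S ^ (2 * k) * S := mul_mem_mul (mul_mem_mul ha hy) (hinv a ha)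
      rwa [← pow_succ', ← pow_succ] at this
    · have : ((S ^ (2 * k)).filter fun z => z * (a * y * a⁻¹) = a * y * a⁻¹ * z).card ≤ 2 := by
        refine le_trans (card_le_card ?_) (card_filter_scalar_le_two (S ^ (2 * k)))
        intro z hz
        obtain ⟨hzS, hzc⟩ := mem_filter.1 hz
        refine mem_filter.2 ⟨hzS, ?_⟩
        by_contra! hzn
        refine hag ⟨z, hzS, hzn, ?_⟩
        refine mul_comm_of_commute_noncentral (conj_ne_smul_one hyc a) hzc ?_
        calc a * g * h₀ * (a * g)⁻¹ * (a * y * a⁻¹) = a * (g * h₀ * g⁻¹ * y) * a⁻¹ := by group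
          _ = a * y * a⁻¹ * (a * g * h₀ * (a * g)⁻¹) := by rw [← hcomm]; group
      nlinarith

/-- The growth of the powers of a symmetric generating set. -/
theorem exists_card_pow_three_le (h2 : (2 : F) ≠ 0)
    {S : Finset (SpecialLinearGroup (Fin 2) F)} (h1 : 1 ∈ S) (hinv : ∀ a ∈ S, a⁻¹ ∈ S)
    (hgen : Subgroup.closure (S : Set (SpecialLinearGroup (Fin 2) F)) = ⊤) {k : ℕ} (hk : 1 ≤ k) :
    ∃ N n : ℕ, N * Nat.card (SpecialLinearGroup (Fin 2) F) ≤
        2 * Nat.card (SpecialLinearGroup (Fin 2) F) + 4 * Fintype.card F * (S ^ (2 * k)).card ∧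
      (S ^ k).card ≤ N * n ∧ (16 ≤ n → n ^ 3 ≤ 256 * (S ^ (8 * k + 7)).card ^ 2) := by
  obtain ⟨h, hh, hhc, hN⟩ := exists_card_commute_le h2 h1 hinv hgen hk
  have hkinv : ∀ m : ℕ, ∀ b ∈ S ^ m, b⁻¹ ∈ S ^ m := fun m b hb => mem_pow_inv hinv m hb
  set X := (S ^ k).image fun b => b * h * b⁻¹ with hX
  refine ⟨_, X.card, hN, ?_, fun h16 => ?_⟩
  -- Two elements of `S ^ k` giving the same conjugate of `h` differ by an element of `S ^ (2 * k)`
  -- that commutes with `h`.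
  · refine card_le_mul_card_image (f := fun b => b * h * b⁻¹) _ _ fun x hx => ?_
    obtain ⟨b₀, hb₀, rfl⟩ := mem_image.1 hx
    refine card_le_card_of_injOn (fun b => b₀⁻¹ * b) ?_ (fun a _ b _ e => by simpa using e)
    intro b hb
    obtain ⟨hb, e⟩ := mem_filter.1 hb
    refine mem_coe.2 (mem_filter.2 ⟨?_, ?_⟩)
    · rw [two_mul, pow_add]
      exact mul_mem_mul (hkinv _ _ hb₀) hb
    · calc b₀⁻¹ * b * h = b₀⁻¹ * (b * h * b⁻¹) * b := by group
        _ = h * (b₀⁻¹ * b) := by rw [e]; group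
  · refine (card_pow_three_le_of_trace_eq h2 h1 hinv hgen
      (t := (h : Matrix (Fin 2) (Fin 2) F).trace) ?_ ?_ h16).trans ?_
    · intro x hx
      obtain ⟨b, -, rfl⟩ := mem_image.1 hx
      rw [Matrix.SpecialLinearGroup.coe_mul, trace_mul_comm, ← Matrix.SpecialLinearGroup.coe_mul,
        inv_mul_cancel_left]
    · intro x hx
      obtain ⟨b, -, rfl⟩ := mem_image.1 hx
      exact conj_ne_smul_one hhc b
    · refine Nat.mul_le_mul_left _ (Nat.pow_le_pow_left (card_le_card ?_) 2)
      have hXS : X ⊆ S ^ (4 * k + 2) := by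
        intro x hx
        obtain ⟨b, hb, rfl⟩ := mem_image.1 hx
        have e : 4 * k + 2 = k + (2 * k + 2) + k := by ring
        rw [e, pow_add, pow_add]
        exact mul_mem_mul (mul_mem_mul hb hh) (hkinv _ _ hb)
      have e : 8 * k + 7 = 4 * k + 2 + 3 + (4 * k + 2) := by ring
      rw [e, pow_add, pow_add]
      exact mul_subset_mul (mul_subset_mul hXS Subset.rfl) hXS

end Growth

/-! ### A sum-product estimate. -/

section SumProduct

open Finset

/-- Cauchy–Schwarz on the fibre sizes of `f`. -/
lemma card_sq_le_card_image_mul_card {α β : Type*} [DecidableEq α] [DecidableEq β]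
    (P : Finset α) (f : α → β) :
    P.card ^ 2 ≤ (P.image f).card * ((P ×ˢ P).filter fun q => f q.1 = f q.2).card := by
  have e1 : P.card = ∑ w ∈ P.image f, (P.filter fun p => f p = w).card :=
    card_eq_sum_card_fiberwise fun p hp => mem_coe.2 (mem_image_of_mem f hp)
  have e2 : ((P ×ˢ P).filter fun q => f q.1 = f q.2).card =
      ∑ w ∈ P.image f, (P.filter fun p => f p = w).card ^ 2 := by
    rw [card_eq_sum_card_fiberwise (f := fun q => f q.1) (t := P.image f)]
    · refine sum_congr rfl fun w _ => ?_
      rw [sq, ← card_product]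
      congr 1
      ext ⟨a, b⟩
      simp only [mem_filter, mem_product]
      constructor
      · rintro ⟨⟨⟨h1, h2⟩, h3⟩, h4⟩
        exact ⟨⟨h1, h4⟩, h2, by rw [← h3, h4]⟩
      · rintro ⟨⟨h1, h2⟩, h3, h4⟩
        exact ⟨⟨⟨h1, h3⟩, by rw [h2, h4]⟩, h2⟩
    · intro q hq
      exact mem_coe.2 (mem_image_of_mem f (mem_product.1 (mem_filter.1 (mem_coe.1 hq)).1).1)
  rw [e2]
  nth_rewrite 1 [e1]
  exact sq_sum_le_card_mul_sum_sq

variable {F : Type*} [Field F] [Fintype F] [DecidableEq F]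

/-- Two distinct points collide for at most one `c`, so with `q = Fintype.card F` there are at most
`|P| q + |P| ^ 2` collisions over all `c`. Were all images of size at most `q / 2`, Cauchy–Schwarz
would give at least `2 |P| ^ 2`, forcing `|P| ≤ q`. -/
lemma exists_lt_two_mul_card_image {P : Finset (F × F)} (hP : Fintype.card F < P.card) :
    ∃ c : F, Fintype.card F < 2 * (P.image fun q => q.1 + c * q.2).card := by
  by_contra! hcon
  set q := Fintype.card F with hq
  have hc : ∀ c : F, 2 * P.card ^ 2 ≤ q * ((P ×ˢ P).filter fun r =>
      r.1.1 + c * r.1.2 = r.2.1 + c * r.2.2).card := by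
    intro c
    have h1 := card_sq_le_card_image_mul_card P fun q => q.1 + c * q.2
    have h2 := hcon c
    nlinarith
  have hsum : ∑ c : F, ((P ×ˢ P).filter fun r =>
      r.1.1 + c * r.1.2 = r.2.1 + c * r.2.2).card ≤ P.card * q + P.card ^ 2 := by
    have e := sum_card_bipartiteAbove_eq_sum_card_bipartiteBelow
      (s := (univ : Finset F)) (t := P ×ˢ P)
      (fun c r => r.1.1 + c * r.1.2 = r.2.1 + c * r.2.2)
    simp only [bipartiteAbove, bipartiteBelow] at e
    rw [e]
    have hr : ∀ r ∈ P ×ˢ P, (univ.filter fun c : F =>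
        r.1.1 + c * r.1.2 = r.2.1 + c * r.2.2).card ≤ (if r.1 = r.2 then q else 0) + 1 := by
      intro r _
      split_ifs with h
      · exact (card_le_univ _).trans (Nat.le_succ _)
      · rw [zero_add, card_le_one]
        intro c hc c' hc'
        have h1 := (mem_filter.1 hc).2
        have h2 := (mem_filter.1 hc').2
        by_contra hne
        have h3 : r.1.2 = r.2.2 := by
          refine sub_eq_zero.1 ((mul_eq_zero.1 (?_ : (c - c') * (r.1.2 - r.2.2) = 0)).resolve_left
            (sub_ne_zero.2 hne))
          linear_combination h1 - h2
        refine h (Prod.ext ?_ h3)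
        rw [h3] at h1
        exact add_right_cancel h1
    refine (sum_le_sum hr).trans ?_
    rw [sum_add_distrib, sum_const, card_product, smul_eq_mul, mul_one, ← sq]
    refine Nat.add_le_add_right ?_ _
    rw [← sum_filter, sum_const, smul_eq_mul]
    refine Nat.mul_le_mul_right _ ?_
    refine card_le_card_of_injOn Prod.fst ?_ ?_
    · intro r hr
      exact (mem_product.1 (mem_filter.1 (mem_coe.1 hr)).1).1
    · intro r hr r' hr' h
      refine Prod.ext h ?_
      rw [← (mem_filter.1 (mem_coe.1 hr)).2, ← (mem_filter.1 (mem_coe.1 hr')).2, h]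
  have htot : q * (2 * P.card ^ 2) ≤ q * (P.card * q + P.card ^ 2) := by
    calc q * (2 * P.card ^ 2) = ∑ _c : F, 2 * P.card ^ 2 := by
          rw [sum_const, card_univ, smul_eq_mul]
      _ ≤ ∑ c : F, q * ((P ×ˢ P).filter fun r =>
          r.1.1 + c * r.1.2 = r.2.1 + c * r.2.2).card := sum_le_sum fun c _ => hc c
      _ ≤ _ := by rw [← mul_sum]; exact Nat.mul_le_mul_left _ hsum
  have hqpos : 0 < q := Fintype.card_pos
  have := Nat.le_of_mul_le_mul_left htot hqpos
  nlinarith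

/-- A sum-product estimate: eight signed products of elements of two large sets cover the field. -/
lemma exists_sum_of_products {X Y : Finset F} (h : Fintype.card F < X.card * Y.card)
    {U : Finset F} (hneg : ∀ s ∈ U, -s ∈ U) (hU : ∀ x ∈ X, ∀ y ∈ Y, x * y ∈ U) (f : F) :
    ∃ a ∈ U, ∃ b ∈ U, ∃ c ∈ U, ∃ d ∈ U, ∃ a' ∈ U, ∃ b' ∈ U, ∃ c' ∈ U, ∃ d' ∈ U,
      f = a + b + c + d + (a' + b' + c' + d') := by
  rw [← card_product] at h
  obtain ⟨c, hc⟩ := exists_lt_two_mul_card_image h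
  set W := (X ×ˢ Y).image fun q => q.1 + c * q.2 with hW
  -- A collision of `x - c * y` exhibits `c` as `(x₁ - x₂) / (y₁ - y₂)`, so `(y₁ - y₂) * (x + c *
  -- y)` expands into four signed products.
  obtain ⟨⟨x₁, y₁⟩, h1, ⟨x₂, y₂⟩, h2, hne, heq⟩ := exists_ne_map_eq_of_card_lt_of_maps_to
    (s := X ×ˢ Y) (t := (univ : Finset F)) (by rwa [card_univ])
    (f := fun q => q.1 - c * q.2) (fun _ _ => mem_coe.2 (mem_univ _))
  obtain ⟨hx1, hy1⟩ := mem_product.1 h1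
  obtain ⟨hx2, hy2⟩ := mem_product.1 h2
  simp only at heq hx1 hx2 hy1 hy2
  have hy : y₁ - y₂ ≠ 0 := by
    intro hy
    have hy' := sub_eq_zero.1 hy
    subst hy'
    exact hne (by rw [sub_left_inj.1 heq])
  have hmul : ∀ w ∈ W, ∃ a ∈ U, ∃ b ∈ U, ∃ c ∈ U, ∃ d ∈ U, (y₁ - y₂) * w = a + b + c + d := by
    intro w hw
    obtain ⟨⟨x, y⟩, hxy, rfl⟩ := mem_image.1 hw
    obtain ⟨hx, hy⟩ := mem_product.1 hxy
    refine ⟨x * y₁, hU _ hx _ hy1, -(x * y₂), hneg _ (hU _ hx _ hy2), x₁ * y, hU _ hx1 _ hy,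
      -(x₂ * y), hneg _ (hU _ hx2 _ hy), ?_⟩
    simp only
    linear_combination -y * heq
  -- More than half of the field: `W` meets every translate of `-W`, so `W + W` is everything.
  have hint : (W ∩ W.image fun w => f / (y₁ - y₂) - w).Nonempty := by
    refine inter_nonempty_of_card_lt_card_add_card (s := (univ : Finset F)) (subset_univ _)
      (subset_univ _) ?_
    rw [card_univ, card_image_of_injective W (sub_right_injective (b := f / (y₁ - y₂)))]
    omega
  obtain ⟨w, hw⟩ := hint
  obtain ⟨hw1, hw2⟩ := mem_inter.1 hw
  obtain ⟨w', hw', e⟩ := mem_image.1 hw2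
  obtain ⟨a, ha, b, hb, d, hd, g, hg, e1⟩ := hmul w hw1
  obtain ⟨a', ha', b', hb', d', hd', g', hg', e2⟩ := hmul w' hw'
  refine ⟨a, ha, b, hb, d, hd, g, hg, a', ha', b', hb', d', hd', g', hg', ?_⟩
  rw [← e1, ← e2, ← mul_add, ← e, sub_add_cancel, mul_div_cancel₀ _ hy]

end SumProduct

/-! ### A large set generates the group in boundedly many steps. -/

section BoundedGeneration

open Matrix Finset
open scoped Pointwise

variable {F : Type*} [Field F]

/-- The upper unipotent elements. -/
def upperUnipotent (s : F) : SpecialLinearGroup (Fin 2) F :=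
  ⟨!![1, s; 0, 1], by simp [det_fin_two]⟩

/-- The Weyl element. -/
def weylElement : SpecialLinearGroup (Fin 2) F :=
  ⟨!![0, 1; -1, 0], by simp [det_fin_two]⟩

lemma ext_fin_two {g h : SpecialLinearGroup (Fin 2) F} (h00 : g 0 0 = h 0 0)
    (h01 : g 0 1 = h 0 1) (h10 : g 1 0 = h 1 0) (h11 : g 1 1 = h 1 1) : g = h :=
  Subtype.ext (matrix_fin_two_ext h00 h01 h10 h11)

lemma det_eq_one_fin_two (g : SpecialLinearGroup (Fin 2) F) :
    g 0 0 * g 1 1 - g 0 1 * g 1 0 = 1 := by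
  rw [← det_fin_two]
  exact g.det_coe

lemma mul_apply_fin_two (g h : SpecialLinearGroup (Fin 2) F) (i j : Fin 2) :
    (g * h) i j = g i 0 * h 0 j + g i 1 * h 1 j := by
  rw [Matrix.SpecialLinearGroup.coe_mul, Matrix.mul_apply, Fin.sum_univ_two]

lemma inv_apply_fin_two (g : SpecialLinearGroup (Fin 2) F) :
    g⁻¹ 0 0 = g 1 1 ∧ g⁻¹ 0 1 = -g 0 1 ∧ g⁻¹ 1 0 = -g 1 0 ∧ g⁻¹ 1 1 = g 0 0 := by
  have : ((g⁻¹ : SpecialLinearGroup (Fin 2) F) : Matrix (Fin 2) (Fin 2) F) = _ :=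
    Matrix.SpecialLinearGroup.coe_inv g
  rw [adjugate_fin_two] at this
  have e := fun i j => congrFun (congrFun this i) j
  exact ⟨e 0 0, e 0 1, e 1 0, e 1 1⟩

@[simp] lemma upperUnipotent_apply (s : F) : upperUnipotent s 0 0 = 1 ∧ upperUnipotent s 0 1 = s ∧
    upperUnipotent s 1 0 = 0 ∧ upperUnipotent s 1 1 = 1 := ⟨rfl, rfl, rfl, rfl⟩

@[simp] lemma weylElement_apply : (weylElement : SpecialLinearGroup (Fin 2) F) 0 0 = 0 ∧
    (weylElement : SpecialLinearGroup (Fin 2) F) 0 1 = 1 ∧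
    (weylElement : SpecialLinearGroup (Fin 2) F) 1 0 = -1 ∧
    (weylElement : SpecialLinearGroup (Fin 2) F) 1 1 = 0 := ⟨rfl, rfl, rfl, rfl⟩

lemma upperUnipotent_add (s t : F) :
    upperUnipotent (s + t) = upperUnipotent s * upperUnipotent t := by
  refine ext_fin_two ?_ ?_ ?_ ?_ <;> simp [mul_apply_fin_two]
  ring

lemma upperUnipotent_neg (s : F) : upperUnipotent (-s) = (upperUnipotent s)⁻¹ := by
  obtain ⟨h1, h2, h3, h4⟩ := inv_apply_fin_two (upperUnipotent s)
  refine ext_fin_two ?_ ?_ ?_ ?_ <;> simp [h1, h2, h3, h4]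

lemma conj_upperUnipotent {b : SpecialLinearGroup (Fin 2) F} (hb : b 1 0 = 0) (s : F) :
    b * upperUnipotent s * b⁻¹ = upperUnipotent (b 0 0 ^ 2 * s) := by
  obtain ⟨h1, h2, h3, h4⟩ := inv_apply_fin_two b
  have hd := det_eq_one_fin_two b
  rw [hb, mul_zero, sub_zero] at hd
  refine ext_fin_two ?_ ?_ ?_ ?_ <;> simp [mul_apply_fin_two, h1, h2, h3, h4, hb]
  · linear_combination hd
  · ring
  · linear_combination hd

/-- Every element of `SL₂` is a product of four unipotent elements. -/
lemma exists_eq_mul_unipotents (g : SpecialLinearGroup (Fin 2) F) : ∃ x y z t : F,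
    g = upperUnipotent x * (weylElement⁻¹ * upperUnipotent y * weylElement) *
      (upperUnipotent z * (weylElement⁻¹ * upperUnipotent t * weylElement)) := by
  obtain ⟨h1, h2, h3, h4⟩ := inv_apply_fin_two (weylElement : SpecialLinearGroup (Fin 2) F)
  have hd := det_eq_one_fin_two g
  by_cases hc : g 1 0 = 0
  · rw [hc, mul_zero, sub_zero] at hd
    have hd0 : g 1 1 ≠ 0 := right_ne_zero_of_mul_eq_one hd
    refine ⟨(g 0 0 + g 0 1 - 1) / g 1 1, -g 1 1, (g 1 1 - 1) / g 1 1, 1, ?_⟩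
    refine ext_fin_two ?_ ?_ ?_ ?_ <;>
      simp [mul_apply_fin_two, h1, h2, h3, h4, hc] <;> field_simp <;> ring_nf
    · exact hd
    · linear_combination -hd
  · refine ⟨(g 0 0 - 1) / g 1 0, -g 1 0, (g 1 1 - 1) / g 1 0, 0, ?_⟩
    refine ext_fin_two ?_ ?_ ?_ ?_ <;>
      simp [mul_apply_fin_two, h1, h2, h3, h4] <;> field_simp <;> ring_nf
    linear_combination -hd

variable [Fintype F] [DecidableEq F]

/-- Elements with the same first column lie in one left coset of the upper unipotent group. -/
lemma card_le_mul_card_upperUnipotent {E : Finset (SpecialLinearGroup (Fin 2) F)}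
    (hinv : ∀ a ∈ E, a⁻¹ ∈ E) :
    E.card ≤ (univ.filter fun s : F => upperUnipotent s ∈ E ^ 2).card *
      (Fintype.card F * Fintype.card F) := by
  rw [← Fintype.card_prod, ← card_univ]
  refine card_le_mul_card_image_of_maps_to (f := fun g : SpecialLinearGroup (Fin 2) F =>
    (g 0 0, g 1 0)) (fun _ _ => mem_univ _) _ fun v _ => ?_
  rcases eq_empty_or_nonempty (E.filter fun g : SpecialLinearGroup (Fin 2) F =>
    (g 0 0, g 1 0) = v) with he | ⟨g₀, hg₀⟩
  · rw [he, card_empty]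
    exact Nat.zero_le _
  · obtain ⟨h1, h2, h3, h4⟩ := inv_apply_fin_two g₀
    have hd0 := det_eq_one_fin_two g₀
    have key : ∀ g ∈ E.filter fun g : SpecialLinearGroup (Fin 2) F => (g 0 0, g 1 0) = v,
        g₀⁻¹ * g = upperUnipotent ((g₀⁻¹ * g) 0 1) := by
      intro g hg
      have e := (mem_filter.1 hg).2.trans (mem_filter.1 hg₀).2.symm
      rw [Prod.mk.injEq] at e
      have hd := det_eq_one_fin_two g
      obtain ⟨e1, e2⟩ := e
      refine ext_fin_two ?_ ?_ ?_ ?_ <;> simp [mul_apply_fin_two, h1, h2, h3, h4]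
      · rw [e1, e2]
        linear_combination hd0
      · rw [e1, e2]
        ring
      · rw [← e1, ← e2]
        linear_combination hd
    refine card_le_card_of_injOn (fun g => (g₀⁻¹ * g) 0 1) ?_ ?_
    · intro g hg
      refine mem_coe.2 (mem_filter.2 ⟨mem_univ _, ?_⟩)
      rw [← key g hg, sq]
      exact mul_mem_mul (hinv _ (mem_filter.1 hg₀).1) (mem_filter.1 hg).1
    · intro g hg g' hg' e
      have e1 := key g hg
      rw [show (g₀⁻¹ * g) 0 1 = (g₀⁻¹ * g') 0 1 from e, ← key g' hg'] at e1
      exact mul_left_cancel e1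

/-- Elements with the same first column up to scaling, a point of the projective line, lie in one
left coset of the upper triangular group, whose elements are fixed by the top row. -/
lemma card_le_mul_card_diagonal {E : Finset (SpecialLinearGroup (Fin 2) F)}
    (hinv : ∀ a ∈ E, a⁻¹ ∈ E) :
    E.card ≤ (univ.filter fun a : F => ∃ b ∈ E ^ 2, b 1 0 = 0 ∧ b 0 0 = a).card *
      Fintype.card F * (Fintype.card F + 1) := by
  rw [← Fintype.card_option, ← card_univ (α := Option F)]
  let line : SpecialLinearGroup (Fin 2) F → Option F := fun g =>
    if g 1 0 = 0 then none else some (g 0 0 / g 1 0)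
  refine card_le_mul_card_image_of_maps_to (f := line) (fun _ _ => mem_univ _) _ fun v _ => ?_
  rcases eq_empty_or_nonempty (E.filter fun g => line g = v) with he | ⟨g₀, hg₀⟩
  · rw [he, card_empty]
    exact Nat.zero_le _
  · obtain ⟨h1, h2, h3, h4⟩ := inv_apply_fin_two g₀
    have key : ∀ g ∈ E.filter fun g => line g = v, (g₀⁻¹ * g) 1 0 = 0 := by
      intro g hg
      have e := (mem_filter.1 hg).2.trans (mem_filter.1 hg₀).2.symm
      rw [mul_apply_fin_two, h3, h4]
      simp only [line] at e
      split_ifs at e with hc hc0 hc0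
      · rw [hc, hc0]
        ring
      · rw [Option.some_inj, div_eq_div_iff hc hc0] at e
        linear_combination -e
    rw [← card_univ (α := F), ← card_product]
    refine card_le_card_of_injOn (fun g => ((g₀⁻¹ * g) 0 0, (g₀⁻¹ * g) 0 1)) ?_ ?_
    · intro g hg
      refine mem_coe.2 (mem_product.2 ⟨mem_filter.2 ⟨mem_univ _, g₀⁻¹ * g, ?_, key g hg, rfl⟩,
        mem_univ _⟩)
      rw [sq]
      exact mul_mem_mul (hinv _ (mem_filter.1 hg₀).1) (mem_filter.1 hg).1
    · intro g hg g' hg' e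
      have e' := Prod.mk.inj e
      have hd := det_eq_one_fin_two (g₀⁻¹ * g)
      have hd' := det_eq_one_fin_two (g₀⁻¹ * g')
      rw [key g hg, mul_zero, sub_zero] at hd
      rw [key g' hg', mul_zero, sub_zero] at hd'
      refine mul_left_cancel (a := g₀⁻¹) (ext_fin_two e'.1 e'.2
        ((key g hg).trans (key g' hg').symm) ?_)
      refine mul_left_cancel₀ (left_ne_zero_of_mul_eq_one hd) (hd.trans ?_)
      rw [e'.1, hd']

/-- A large symmetric subset of `SL₂` generates the upper unipotent elements quickly. -/
lemma upperUnipotent_mem_pow {E : Finset (SpecialLinearGroup (Fin 2) F)}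
    (hinv : ∀ a ∈ E, a⁻¹ ∈ E)
    (hcard : 2 * Fintype.card F ^ 4 * (Fintype.card F + 1) < E.card ^ 2) (f : F) :
    upperUnipotent f ∈ (E ^ 6) ^ 8 := by
  set q := Fintype.card F with hq
  set U := univ.filter fun s : F => upperUnipotent s ∈ E ^ 2 with hU
  set D := univ.filter fun a : F => ∃ b ∈ E ^ 2, b 1 0 = 0 ∧ b 0 0 = a with hD
  have hU1 : E.card ≤ U.card * (q * q) := card_le_mul_card_upperUnipotent hinv
  have hD1 : E.card ≤ D.card * q * (q + 1) := card_le_mul_card_diagonal hinv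
  -- Conjugation by an upper triangular element scales the unipotent parameter by the square of its
  -- diagonal entry.
  have hD2 : D.card ≤ 2 * (D.image fun a => a ^ 2).card := by
    refine card_le_mul_card_image (f := fun a => a ^ 2) _ _ fun w _ => ?_
    refine (card_le_card ?_).trans (card_filter_quadratic_le_two (F := F) 0 (-w))
    intro a ha
    refine mem_filter.2 ⟨mem_univ _, ?_⟩
    rw [← (mem_filter.1 ha).2]
    ring
  have hprod : q < (D.image fun a => a ^ 2).card * U.card := by
    generalize (D.image fun a => a ^ 2).card = x at *
    generalize U.card = u at *
    generalize D.card = d at *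
    generalize E.card = e at *
    have hqpos : 0 < q := Fintype.card_pos
    by_contra! hcon
    have : e ^ 2 ≤ 2 * q ^ 4 * (q + 1) := by
      calc e ^ 2 = e * e := sq e
        _ ≤ (u * (q * q)) * (d * q * (q + 1)) := Nat.mul_le_mul hU1 hD1
        _ ≤ (u * (q * q)) * (2 * x * q * (q + 1)) := by gcongr
        _ = 2 * q ^ 3 * (q + 1) * (x * u) := by ring
        _ ≤ 2 * q ^ 3 * (q + 1) * q := Nat.mul_le_mul_left _ hcon
        _ = _ := by ring
    omega
  obtain ⟨a, ha, b, hb, c, hc, d, hd, a', ha', b', hb', c', hc', d', hd', rfl⟩ :=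
    exists_sum_of_products hprod (U := univ.filter fun s : F => upperUnipotent s ∈ E ^ 6)
      (fun s hs => mem_filter.2 ⟨mem_univ _, by
        rw [upperUnipotent_neg]
        exact mem_pow_inv hinv 6 (mem_filter.1 hs).2⟩)
      (fun x hx s hs => mem_filter.2 ⟨mem_univ _, by
        obtain ⟨a, ha, rfl⟩ := mem_image.1 hx
        obtain ⟨b, hb, hb0, rfl⟩ := (mem_filter.1 ha).2
        rw [← conj_upperUnipotent hb0, show 6 = 2 + 2 + 2 from rfl, pow_add, pow_add]
        exact mul_mem_mul (mul_mem_mul hb (mem_filter.1 hs).2) (mem_pow_inv hinv 2 hb)⟩) f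
  simp only [mem_filter, mem_univ, true_and] at ha hb hc hd ha' hb' hc' hd'
  simp only [upperUnipotent_add]
  rw [show 8 = 1 + 1 + 1 + 1 + (1 + 1 + 1 + 1) from rfl]
  simp only [pow_add _ (_ + _), pow_add _ 1 1, pow_one (E ^ 6)]
  exact mul_mem_mul (mul_mem_mul (mul_mem_mul (mul_mem_mul ha hb) hc) hd)
    (mul_mem_mul (mul_mem_mul (mul_mem_mul ha' hb') hc') hd')

/-- A large symmetric subset of `SL₂` generates it in boundedly many steps. -/
theorem pow_eq_univ_of_card {E : Finset (SpecialLinearGroup (Fin 2) F)}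
    (hinv : ∀ a ∈ E, a⁻¹ ∈ E)
    (hcard : 2 * Fintype.card F ^ 4 * (Fintype.card F + 1) < E.card ^ 2) :
    ((E ^ 6) ^ 8) ^ 4 = univ := by
  have hu := upperUnipotent_mem_pow hinv hcard
  -- The lower unipotents come from the same lemma applied to the conjugate of `E` by the Weyl
  -- element.
  have hl : ∀ f : F, weylElement⁻¹ * upperUnipotent f * weylElement ∈ (E ^ 6) ^ 8 := by
    intro f
    have hc : (E.image (MulAut.conj weylElement)).card = E.card :=
      card_image_of_injective _ (MulEquiv.injective _)
    have := upperUnipotent_mem_pow (E := E.image (MulAut.conj weylElement)) (by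
      intro a ha
      obtain ⟨b, hb, rfl⟩ := mem_image.1 ha
      exact mem_image.2 ⟨b⁻¹, hinv b hb, map_inv _ _⟩) (by rwa [hc]) f
    rw [← image_pow, ← image_pow] at this
    obtain ⟨g, hg, e⟩ := mem_image.1 this
    rw [← e, MulAut.conj_apply]
    convert hg using 1
    group
  refine eq_univ_iff_forall.2 fun g => ?_
  obtain ⟨x, y, z, t, rfl⟩ := exists_eq_mul_unipotents g
  rw [show 4 = 1 + 1 + (1 + 1) from rfl, pow_add, pow_add, pow_one]
  exact mul_mem_mul (mul_mem_mul (hu x) (hl y)) (mul_mem_mul (hu z) (hl t))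

lemma card_specialLinearGroup_le :
    Nat.card (SpecialLinearGroup (Fin 2) F) ≤ Fintype.card F ^ 3 := by
  have : Fintype.card F ^ 3 = Fintype.card (F × F × F) := by
    simp only [Fintype.card_prod]
    ring
  rw [this, Nat.card_eq_fintype_card]
  refine Fintype.card_le_of_injective (fun g : SpecialLinearGroup (Fin 2) F =>
    if g 0 0 = 0 then (0, g 1 0, g 1 1) else (g 0 0, g 0 1, g 1 0)) ?_
  intro g h e
  have hg := det_eq_one_fin_two g
  have hh := det_eq_one_fin_two h
  simp only at e
  split_ifs at e with h1 h2 h2 <;> simp only [Prod.mk.injEq] at e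
  · rw [h1, zero_mul, zero_sub] at hg
    rw [h2, zero_mul, zero_sub, ← e.2.1] at hh
    have hne : g 1 0 ≠ 0 := fun h => by simp [h] at hg
    exact ext_fin_two (h1.trans h2.symm)
      (mul_right_cancel₀ hne (neg_injective (hg.trans hh.symm))) e.2.1 e.2.2
  · exact absurd e.1.symm h2
  · exact absurd e.1 h1
  · refine ext_fin_two e.1 e.2.1 e.2.2 (mul_left_cancel₀ h1 ?_)
    rw [← e.1, ← e.2.1, ← e.2.2] at hh
    linear_combination hg - hh

lemma le_card_specialLinearGroup :
    (Fintype.card F - 1) * Fintype.card F ^ 2 ≤ Nat.card (SpecialLinearGroup (Fin 2) F) := by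
  have : (Fintype.card F - 1) * Fintype.card F ^ 2 = Fintype.card (Fˣ × F × F) := by
    simp only [Fintype.card_prod, Fintype.card_units]
    ring
  rw [this, Nat.card_eq_fintype_card]
  refine Fintype.card_le_of_injective (fun r : Fˣ × F × F =>
    (⟨!![(r.1 : F), r.2.1; r.2.2, (r.1 : F)⁻¹ * (1 + r.2.1 * r.2.2)], by
      simp [det_fin_two]⟩ : SpecialLinearGroup (Fin 2) F)) ?_
  rintro ⟨a, b, c⟩ ⟨a', b', c'⟩ e
  have e' := congrArg (fun g : SpecialLinearGroup (Fin 2) F => (g 0 0, g 0 1, g 1 0)) e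
  simpa [Units.ext_iff] using e'

end BoundedGeneration

/-! ### Iterating the growth, and the final jump to the whole group. -/

section Iteration

open Matrix Finset
open scoped Pointwise

variable {F : Type*} [Field F] [Fintype F] [DecidableEq F]

lemma two_mul_card_pow_three_le (hq : 3 ≤ Fintype.card F) :
    2 * Fintype.card F ^ 3 ≤ 3 * Nat.card (SpecialLinearGroup (Fin 2) F) := by
  have h := le_card_specialLinearGroup (F := F)
  obtain ⟨r, hr⟩ := Nat.exists_eq_add_of_le' hq
  rw [hr] at h ⊢
  simp only [show r + 3 - 1 = r + 2 by omega] at h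
  nlinarith [sq_nonneg r]

variable {S : Finset (SpecialLinearGroup (Fin 2) F)}

/-- The growth of the powers of a symmetric generating set which are not too large. -/
lemma card_pow_three_le_of_card_le (h2 : (2 : F) ≠ 0) (hq : 3 ≤ Fintype.card F) (h1 : 1 ∈ S)
    (hinv : ∀ a ∈ S, a⁻¹ ∈ S)
    (hgen : Subgroup.closure (S : Set (SpecialLinearGroup (Fin 2) F)) = ⊤) {k : ℕ} (hk : 1 ≤ k)
    (hsmall : (S ^ (2 * k)).card ≤ Fintype.card F ^ 2) (hlarge : 128 ≤ (S ^ k).card) :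
    (S ^ k).card ^ 3 ≤ 2 ^ 17 * (S ^ (8 * k + 7)).card ^ 2 := by
  obtain ⟨N, n, hN, hn, h⟩ := exists_card_pow_three_le h2 h1 hinv hgen hk
  have hG := two_mul_card_pow_three_le hq
  have hpos : 0 < Nat.card (SpecialLinearGroup (Fin 2) F) := Nat.card_pos
  generalize Nat.card (SpecialLinearGroup (Fin 2) F) = G at *
  generalize Fintype.card F = q at *
  -- Here `q ^ 3` is at most `3/2` times the group order, so the bound on `N` is at most `2 + 6`.
  have hN8 : N ≤ 8 := by
    refine Nat.le_of_mul_le_mul_right (hN.trans ?_) hpos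
    have := Nat.mul_le_mul_left (4 * q) hsmall
    calc 2 * G + 4 * q * (S ^ (2 * k)).card ≤ 2 * G + 4 * q * q ^ 2 := by omega
      _ = 2 * G + 2 * (2 * q ^ 3) := by ring
      _ ≤ 8 * G := by omega
  have hn8 : (S ^ k).card ≤ 8 * n := hn.trans (Nat.mul_le_mul_right n hN8)
  calc (S ^ k).card ^ 3 ≤ (8 * n) ^ 3 := Nat.pow_le_pow_left hn8 3
    _ = 512 * n ^ 3 := by ring
    _ ≤ 512 * (256 * (S ^ (8 * k + 7)).card ^ 2) := Nat.mul_le_mul_left _ (h (by omega))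
    _ = _ := by ring

/-- Among the iterated doublings of a large power one does not grow much. -/
lemma exists_small_doubling (h1 : 1 ∈ S) {k : ℕ}
    (hlarge : Fintype.card F ^ 2 < (S ^ (2 * k)).card) :
    ∃ m, 1 ≤ m ∧ m ≤ 16 * k ∧ Fintype.card F ^ 2 < (S ^ m).card ∧
      (S ^ (2 * m)).card ^ 4 ≤ Fintype.card F * (S ^ m).card ^ 4 := by
  by_contra! hcon
  have hk : 1 ≤ k := by
    by_contra! hk
    obtain rfl : k = 0 := by omega
    simp only [mul_zero, pow_zero, card_one] at hlarge
    have : 0 < Fintype.card F ^ 2 := pow_pos Fintype.card_pos 2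
    omega
  have hmono : ∀ {a b : ℕ}, a ≤ b → (S ^ a).card ≤ (S ^ b).card := fun h =>
    card_le_card (pow_subset_pow_right h1 h)
  -- Four successive doublings, each gaining more than `q ^ (1/4)`, would lead from above `q ^ 2` to
  -- above `q ^ 3`, the bound for the group order.
  have c0 := hcon (2 * k) (by omega) (by omega) hlarge
  have c1 := hcon (2 * (2 * k)) (by omega) (by omega) (hlarge.trans_le (hmono (by omega)))
  have c2 := hcon (2 * (2 * (2 * k))) (by omega) (by omega) (hlarge.trans_le (hmono (by omega)))
  have c3 := hcon (2 * (2 * (2 * (2 * k)))) (by omega) (by omega)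
    (hlarge.trans_le (hmono (by omega)))
  have hG : (S ^ (2 * (2 * (2 * (2 * (2 * k)))))).card ≤ Fintype.card F ^ 3 := by
    refine le_trans ?_ (card_specialLinearGroup_le (F := F))
    rw [Nat.card_eq_fintype_card]
    exact card_le_univ _
  generalize Fintype.card F = q at *
  have : q ^ 4 * (q ^ 2) ^ 4 < q ^ 4 * (q ^ 2) ^ 4 := by
    calc q ^ 4 * (q ^ 2) ^ 4 ≤ q ^ 4 * (S ^ (2 * k)).card ^ 4 := by gcongr
      _ = q * (q * (q * (q * (S ^ (2 * k)).card ^ 4))) := by ring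
      _ ≤ q * (q * (q * (S ^ (2 * (2 * k))).card ^ 4)) := by gcongr
      _ ≤ q * (q * (S ^ (2 * (2 * (2 * k)))).card ^ 4) := by gcongr
      _ ≤ q * (S ^ (2 * (2 * (2 * (2 * k))))).card ^ 4 := by gcongr
      _ < (S ^ (2 * (2 * (2 * (2 * (2 * k)))))).card ^ 4 := c3
      _ ≤ (q ^ 3) ^ 4 := by gcongr
      _ = q ^ 4 * (q ^ 2) ^ 4 := by ring
  exact lt_irrefl _ this

/-- A power of a symmetric generating set which is large generates quickly. -/
lemma pow_eq_univ_of_large (h2 : (2 : F) ≠ 0) (hq : 2 ^ 76 < Fintype.card F) (h1 : 1 ∈ S)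
    (hinv : ∀ a ∈ S, a⁻¹ ∈ S)
    (hgen : Subgroup.closure (S : Set (SpecialLinearGroup (Fin 2) F)) = ⊤) {k : ℕ}
    (hlarge : Fintype.card F ^ 2 < (S ^ (2 * k)).card) :
    ∃ M ≤ 25920 * k, S ^ M = univ := by
  obtain ⟨m, hm1, hmk, hmq, hdbl⟩ := exists_small_doubling h1 hlarge
  obtain ⟨N, n, hN, hn, h⟩ := exists_card_pow_three_le h2 h1 hinv hgen hm1
  -- With `m ≤ 16 * k` and `1 ≤ k` this is at most `24576 * k + 1344 ≤ 25920 * k`.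
  refine ⟨(8 * m + 7) * 6 * 8 * 4, by omega, ?_⟩
  rw [pow_mul, pow_mul, pow_mul]
  refine pow_eq_univ_of_card (fun a ha => mem_pow_inv hinv _ ha) ?_
  have hG := two_mul_card_pow_three_le (F := F) (by omega)
  have hpos : 0 < Nat.card (SpecialLinearGroup (Fin 2) F) := Nat.card_pos
  have hs : (S ^ m).card ≤ (S ^ (2 * m)).card :=
    card_le_card (pow_subset_pow_right h1 (by omega))
  generalize Nat.card (SpecialLinearGroup (Fin 2) F) = G at *
  generalize Fintype.card F = q at *
  generalize (S ^ (8 * m + 7)).card = t at *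
  generalize (S ^ (2 * m)).card = s' at *
  generalize (S ^ m).card = r at *
  have hq0 : 0 < q := by omega
  have hNq : N * q ^ 2 ≤ 8 * s' := by
    refine Nat.le_of_mul_le_mul_right ?_ hpos
    calc N * q ^ 2 * G = N * G * q ^ 2 := by ring
      _ ≤ (2 * G + 4 * q * s') * q ^ 2 := Nat.mul_le_mul_right _ hN
      _ = 2 * G * q ^ 2 + 2 * (2 * q ^ 3) * s' := by ring
      _ ≤ 2 * G * s' + 2 * (3 * G) * s' := by gcongr; omega
      _ = 8 * s' * G := by ring
  have hr : r * q ^ 2 ≤ 8 * s' * n := by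
    calc r * q ^ 2 ≤ N * n * q ^ 2 := Nat.mul_le_mul_right _ hn
      _ = N * q ^ 2 * n := by ring
      _ ≤ _ := Nat.mul_le_mul_right _ hNq
  have hn4 : q ^ 7 ≤ 4096 * n ^ 4 := by
    have hr0 : 0 < r ^ 4 * q := by
      have : 0 < r := by omega
      positivity
    refine Nat.le_of_mul_le_mul_left ?_ hr0
    calc r ^ 4 * q * q ^ 7 = (r * q ^ 2) ^ 4 := by ring
      _ ≤ (8 * s' * n) ^ 4 := Nat.pow_le_pow_left hr 4
      _ = 4096 * n ^ 4 * s' ^ 4 := by ring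
      _ ≤ 4096 * n ^ 4 * (q * r ^ 4) := Nat.mul_le_mul_left _ hdbl
      _ = _ := by ring
  have hn16 : 16 ≤ n := by
    by_contra! hlt
    have e1 : n ^ 4 ≤ 16 ^ 4 := Nat.pow_le_pow_left hlt.le 4
    have e2 : q ≤ q ^ 7 := Nat.le_self_pow (by norm_num) q
    have e3 : 4096 * 16 ^ 4 ≤ 2 ^ 76 := by norm_num
    omega
  have ht := h hn16
  by_contra! hcon
  have hq5 : t ^ 2 ≤ 4 * q ^ 5 := by
    calc t ^ 2 ≤ 2 * q ^ 4 * (q + 1) := hcon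
      _ ≤ 2 * q ^ 4 * (q + q) := by gcongr; omega
      _ = _ := by ring
  -- Up to constants `n ≥ q ^ (7/4)`, so `t ≥ n ^ (3/2) ≥ q ^ (21/8)`, beating `q ^ (5/2)`.
  -- Collecting the constants gives the threshold `2 ^ 76` for `q`.
  have : q ^ 20 * q ≤ q ^ 20 * 2 ^ 76 := by
    calc q ^ 20 * q = (q ^ 7) ^ 3 := by ring
      _ ≤ (4096 * n ^ 4) ^ 3 := Nat.pow_le_pow_left hn4 3
      _ = 4096 ^ 3 * (n ^ 3) ^ 4 := by ring
      _ ≤ 4096 ^ 3 * (256 * (4 * q ^ 5)) ^ 4 := by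
        gcongr
        exact ht.trans (Nat.mul_le_mul_left _ hq5)
      _ = q ^ 20 * 2 ^ 76 := by ring
  have := Nat.le_of_mul_le_mul_left this (by positivity)
  omega

/-- The number of steps which are needed to reach a large power. -/
lemma exists_large_pow (h2 : (2 : F) ≠ 0) (hq : 3 ≤ Fintype.card F) (h1 : 1 ∈ S)
    (hinv : ∀ a ∈ S, a⁻¹ ∈ S)
    (hgen : Subgroup.closure (S : Set (SpecialLinearGroup (Fin 2) F)) = ⊤)
    (hS : 2 ^ 17 < S.card) :
    ∃ k : ℕ, Fintype.card F ^ 2 < (S ^ (2 * k)).card ∧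
      (k : ℝ) ≤ 16 * (Real.log (Nat.card (SpecialLinearGroup (Fin 2) F)) /
        Real.log (S.card / 2 ^ 17)) ^ Real.logb (3 / 2) 8 := by
  have hmono : ∀ {a b : ℕ}, a ≤ b → (S ^ a).card ≤ (S ^ b).card := fun h =>
    card_le_card (pow_subset_pow_right h1 h)
  have hS17 : (2 ^ 17 : ℝ) < S.card := by exact_mod_cast hS
  have hlog0 : 0 < Real.log (S.card / 2 ^ 17) :=
    Real.log_pos (by rw [lt_div_iff₀ (by positivity)]; linarith)
  have hG1 : (S.card : ℝ) ≤ Nat.card (SpecialLinearGroup (Fin 2) F) := by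
    rw [Nat.card_eq_fintype_card]
    exact_mod_cast card_le_univ S
  -- The solution of `κ (i + 1) = 8 * κ i + 7` with `κ 0 = 1`.
  let κ : ℕ → ℕ := fun i => 2 * 8 ^ i - 1
  have hκ1 : ∀ i, 1 ≤ κ i := fun i => by
    have : 0 < 8 ^ i := by positivity
    simp only [κ]
    omega
  have hκs : ∀ i, κ (i + 1) = 8 * κ i + 7 := fun i => by
    have : 0 < 8 ^ i := by positivity
    simp only [κ, pow_succ]
    omega
  have hlogG : Real.log (S.card / 2 ^ 17) ≤
      Real.log (Nat.card (SpecialLinearGroup (Fin 2) F)) := by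
    refine Real.log_le_log (by positivity) ((div_le_self (by positivity) (by norm_num)).trans hG1)
  have hgrow : ∀ i, (∀ j < i, (S ^ (2 * κ j)).card ≤ Fintype.card F ^ 2) →
      (3 / 2 : ℝ) ^ i * Real.log (S.card / 2 ^ 17) ≤ Real.log ((S ^ κ i).card / 2 ^ 17) := by
    intro i
    induction i with
    | zero => intro _; simp [κ]
    | succ i ih =>
      intro hi
      have hS1 : S.card ≤ (S ^ κ i).card := by
        simpa using hmono (hκ1 i)
      have h3 := card_pow_three_le_of_card_le h2 hq h1 hinv hgen (hκ1 i)
        (hi i (Nat.lt_succ_self i)) (by omega)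
      rw [← hκs] at h3
      have h3' : ((S ^ κ i).card : ℝ) ^ 3 ≤ 2 ^ 17 * ((S ^ κ (i + 1)).card : ℝ) ^ 2 := by
        exact_mod_cast h3
      have hpos : (0 : ℝ) < (S ^ κ i).card := by
        have : 0 < (S ^ κ i).card := by omega
        exact_mod_cast this
      -- Dividing sizes by `2 ^ 17` absorbs the constant of the growth estimate exactly.
      have h4 : (((S ^ κ i).card : ℝ) / 2 ^ 17) ^ 3 ≤ ((S ^ κ (i + 1)).card / 2 ^ 17) ^ 2 := by
        rw [div_pow, div_pow, div_le_div_iff₀ (by positivity) (by positivity)]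
        nlinarith
      have h5 := Real.log_le_log (by positivity) h4
      rw [Real.log_pow, Real.log_pow] at h5
      push_cast at h5
      have h6 := ih fun j hj => hi j (hj.trans (Nat.lt_succ_self i))
      rw [pow_succ]
      linarith
  have hbound : ∀ i, (∀ j ≤ i, (S ^ (2 * κ j)).card ≤ Fintype.card F ^ 2) →
      (3 / 2 : ℝ) ^ i ≤ Real.log (Nat.card (SpecialLinearGroup (Fin 2) F)) /
        Real.log (S.card / 2 ^ 17) := by
    intro i hi
    rw [le_div_iff₀ hlog0]
    refine (hgrow i fun j hj => hi j hj.le).trans (Real.log_le_log ?_ ?_)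
    · have : 0 < (S ^ κ i).card := card_pos.2 ⟨1, one_mem_pow h1⟩
      positivity
    · refine (div_le_self (by positivity) (by norm_num)).trans ?_
      rw [Nat.card_eq_fintype_card]
      exact_mod_cast card_le_univ _
  have hex : ∃ i, Fintype.card F ^ 2 < (S ^ (2 * κ i)).card := by
    by_contra! hcon
    obtain ⟨i, hi⟩ := pow_unbounded_of_one_lt
      (Real.log (Nat.card (SpecialLinearGroup (Fin 2) F)) / Real.log (S.card / 2 ^ 17))
      (by norm_num : (1 : ℝ) < 3 / 2)
    exact absurd (hbound i fun j _ => hcon j) (not_le.2 hi)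
  classical
  have hd : 0 ≤ Real.logb (3 / 2) 8 := Real.logb_nonneg (by norm_num) (by norm_num)
  refine ⟨κ (Nat.find hex), Nat.find_spec hex, ?_⟩
  have hmin : ∀ j < Nat.find hex, (S ^ (2 * κ j)).card ≤ Fintype.card F ^ 2 := fun j hj =>
    not_lt.1 (Nat.find_min hex hj)
  generalize Nat.find hex = i at *
  have h8 : ∀ j : ℕ, (8 : ℝ) ^ j = ((3 / 2 : ℝ) ^ j) ^ Real.logb (3 / 2) 8 := by
    intro j
    rw [← Real.rpow_natCast (3 / 2) j, ← Real.rpow_mul (by norm_num), mul_comm,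
      Real.rpow_mul (by norm_num), Real.rpow_logb (by norm_num) (by norm_num) (by norm_num),
      Real.rpow_natCast]
  -- The index `i` is the first at which the power is large; the bound on `(3 / 2) ^ i` is available
  -- only for the preceding index, at the cost of a factor 8.
  cases i with
  | zero =>
    have : (1 : ℝ) ≤ (Real.log (Nat.card (SpecialLinearGroup (Fin 2) F)) /
        Real.log (S.card / 2 ^ 17)) ^ Real.logb (3 / 2) 8 :=
      Real.one_le_rpow ((one_le_div hlog0).2 hlogG) hd
    have h11 : (κ 0 : ℝ) = 1 := by simp [κ]
    linarith
  | succ i =>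
    have h9 : (8 : ℝ) ^ i ≤ (Real.log (Nat.card (SpecialLinearGroup (Fin 2) F)) /
        Real.log (S.card / 2 ^ 17)) ^ Real.logb (3 / 2) 8 := by
      rw [h8]
      exact Real.rpow_le_rpow (by positivity) (hbound i fun j hj => hmin j (Nat.lt_succ_of_le hj))
        hd
    have h10 : (κ (i + 1) : ℝ) ≤ 16 * 8 ^ i := by
      have : κ (i + 1) ≤ 16 * 8 ^ i := by
        simp only [κ, pow_succ]
        omega
      exact_mod_cast this
    linarith

end Iteration

/-! ### From covering powers to the diameter of the Cayley graph. -/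

section Diameter

open Finset
open scoped Pointwise

lemma edist_mulCayley_le {G : Type*} [Group G] [DecidableEq G] {A : Set G} {S : Finset G}
    (hS : ∀ a ∈ S, a = 1 ∨ a ∈ A) (m : ℕ) :
    ∀ g ∈ S ^ m, ∀ u : G, (SimpleGraph.mulCayley A).edist u (u * g) ≤ m := by
  induction m with
  | zero =>
    intro g hg u
    rw [pow_zero, mem_one] at hg
    simp [hg]
  | succ m ih =>
    intro g hg u
    rw [pow_succ] at hg
    obtain ⟨h, hh, a, ha, rfl⟩ := mem_mul.1 hg
    refine (SimpleGraph.edist_triangle (v := u * h)).trans ?_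
    push_cast
    refine add_le_add (ih h hh u) ?_
    rw [← mul_assoc]
    by_cases ha1 : a = 1
    · simp [ha1]
    · refine (SimpleGraph.edist_eq_one_iff_adj.2 ?_).le
      rw [SimpleGraph.mulCayley_adj']
      exact ⟨fun h => ha1 (by simpa using h), a, (hS a ha).resolve_left ha1, Or.inl rfl⟩

lemma connected_and_diam_mulCayley_le {G : Type*} [Group G] [Fintype G] [DecidableEq G]
    {A : Set G} {S : Finset G} (hS : ∀ a ∈ S, a = 1 ∨ a ∈ A) {m : ℕ} (hm : S ^ m = univ) :
    (SimpleGraph.mulCayley A).Connected ∧ (SimpleGraph.mulCayley A).diam ≤ m := by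
  have h : (SimpleGraph.mulCayley A).ediam ≤ m :=
    SimpleGraph.ediam_le_of_edist_le fun u v => by
      have := edist_mulCayley_le hS m (u⁻¹ * v) (by rw [hm]; exact mem_univ _) u
      rwa [mul_inv_cancel_left] at this
  refine ⟨SimpleGraph.connected_of_ediam_ne_top (ne_top_of_le_ne_top (ENat.natCast_ne_top m) h), ?_⟩
  exact ENat.toNat_le_of_le_natCast h

end Diameter

/-! ### The diameter bound. -/

theorem corollary1 :
    ∃ C : ℝ, 1 < C ∧
      ∀ (p : ℕ) [Fact p.Prime]
        (A : Set (Matrix.SpecialLinearGroup (Fin 2) (ZMod p))),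
        (∀ a ∈ A, a⁻¹ ∈ A) →
        Subgroup.closure A = ⊤ →
        C < (A.ncard : ℝ) →
          (SimpleGraph.mulCayley A).Connected ∧
          ((SimpleGraph.mulCayley A).diam : ℝ) ≤
            C * (Real.log (Nat.card (Matrix.SpecialLinearGroup (Fin 2) (ZMod p)) : ℝ) /
                  Real.log ((A.ncard : ℝ) / C)) ^ (Real.logb (3 / 2) 8) := by
  -- As the group has at most `q ^ 3` elements, `|A| > 2 ^ 228` forces `q > 2 ^ 76`; smaller primes
  -- are excluded vacuously.
  refine ⟨2 ^ 228, by norm_num, ?_⟩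
  intro p _ A hinv hgen hA
  classical
  -- Adjoining the identity makes the powers nested and changes the Cayley graph only by trivial
  -- steps.
  set S : Finset (Matrix.SpecialLinearGroup (Fin 2) (ZMod p)) := insert 1 A.toFinset with hS
  have hSA : ∀ a ∈ S, a = 1 ∨ a ∈ A := fun a ha => by simpa [hS] using ha
  have h1 : 1 ∈ S := Finset.mem_insert_self _ _
  have hSinv : ∀ a ∈ S, a⁻¹ ∈ S := by
    intro a ha
    rcases hSA a ha with rfl | ha
    · simpa using h1
    · exact Finset.mem_insert_of_mem (Set.mem_toFinset.2 (hinv a ha))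
  have hSgen : Subgroup.closure
      (S : Set (Matrix.SpecialLinearGroup (Fin 2) (ZMod p))) = ⊤ := by
    refine top_le_iff.1 (hgen ▸ Subgroup.closure_mono fun a ha => ?_)
    exact Finset.mem_coe.2 (Finset.mem_insert_of_mem (Set.mem_toFinset.2 ha))
  have hAS : A.ncard ≤ S.card := by
    rw [Set.ncard_eq_toFinset_card']
    exact Finset.card_le_card (Finset.subset_insert _ _)
  have hAS' : (A.ncard : ℝ) ≤ S.card := by exact_mod_cast hAS
  have hSG : S.card ≤ Nat.card (Matrix.SpecialLinearGroup (Fin 2) (ZMod p)) := by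
    rw [Nat.card_eq_fintype_card]
    exact Finset.card_le_univ S
  have hA' : 2 ^ 228 < A.ncard := by exact_mod_cast hA
  have hq : 2 ^ 76 < Fintype.card (ZMod p) := by
    have h3 := card_specialLinearGroup_le (F := ZMod p)
    refine lt_of_pow_lt_pow_left₀ 3 (Nat.zero_le _) ?_
    calc (2 ^ 76) ^ 3 = 2 ^ 228 := by norm_num
      _ < A.ncard := hA'
      _ ≤ _ := (hAS.trans hSG).trans h3
  have h2 : (2 : ZMod p) ≠ 0 := by
    intro h
    have hp : p ∣ 2 := (ZMod.natCast_eq_zero_iff 2 p).1 (by exact_mod_cast h)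
    rw [ZMod.card] at hq
    have := Nat.le_of_dvd two_pos hp
    omega
  obtain ⟨k, hk, hkL⟩ := exists_large_pow h2 (by omega) h1 hSinv hSgen (by omega)
  obtain ⟨M, hM, hMS⟩ := pow_eq_univ_of_large h2 hq h1 hSinv hSgen hk
  obtain ⟨hconn, hdiam⟩ := connected_and_diam_mulCayley_le hSA hMS
  refine ⟨hconn, ?_⟩
  have hlogA : 0 < Real.log ((A.ncard : ℝ) / 2 ^ 228) :=
    Real.log_pos (by rw [lt_div_iff₀ (by positivity)]; linarith)
  have hlog : Real.log ((A.ncard : ℝ) / 2 ^ 228) ≤ Real.log ((S.card : ℝ) / 2 ^ 17) := by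
    have hApos : (0 : ℝ) < A.ncard := lt_trans (by positivity) hA
    refine Real.log_le_log (by positivity) ?_
    exact div_le_div₀ (by positivity) hAS' (by positivity)
      (pow_le_pow_right₀ (by norm_num) (by norm_num))
  have hlogG : 0 ≤ Real.log (Nat.card (Matrix.SpecialLinearGroup (Fin 2) (ZMod p))) :=
    Real.log_natCast_nonneg _
  have hL : (Real.log (Nat.card (Matrix.SpecialLinearGroup (Fin 2) (ZMod p))) /
        Real.log ((S.card : ℝ) / 2 ^ 17)) ^ Real.logb (3 / 2) 8 ≤
      (Real.log (Nat.card (Matrix.SpecialLinearGroup (Fin 2) (ZMod p))) /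
        Real.log ((A.ncard : ℝ) / 2 ^ 228)) ^ Real.logb (3 / 2) 8 :=
    Real.rpow_le_rpow (div_nonneg hlogG (hlogA.le.trans hlog))
      (div_le_div_of_nonneg_left hlogG hlogA hlog)
      (Real.logb_nonneg (by norm_num) (by norm_num))
  have hLnonneg : 0 ≤ (Real.log (Nat.card (Matrix.SpecialLinearGroup (Fin 2) (ZMod p))) /
        Real.log ((A.ncard : ℝ) / 2 ^ 228)) ^ Real.logb (3 / 2) 8 :=
    Real.rpow_nonneg (div_nonneg hlogG hlogA.le) _
  have hd : ((SimpleGraph.mulCayley A).diam : ℝ) ≤ 25920 * k := by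
    exact_mod_cast hdiam.trans hM
  calc ((SimpleGraph.mulCayley A).diam : ℝ) ≤ 25920 * k := hd
    _ ≤ 25920 * (16 * _) := mul_le_mul_of_nonneg_left (hkL.trans
        (mul_le_mul_of_nonneg_left hL (by norm_num))) (by norm_num)
    _ = 414720 * _ := by ring
    _ ≤ 2 ^ 228 * _ := mul_le_mul_of_nonneg_right (by norm_num) hLnonneg
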